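/- For $a\in\mathbb R$ let $\mathbb C_a=\{s\in\mathbb C:\ \Re s>a\}$. Let $1\le p<\infty$ and let $\mathcal H^p$ be the completion of the space of Dirichlet polynomials $\sum_{n=1}^N a_n n^{-s}$ under the norm $$\Big\|\sum_{n=1}^N a_nn^{-s}\Big\|_p=\Big(\lim_{T\to+\infty}\frac1{2T}\int_{-T}^T\Big|\sum_{n=1}^N a_nn^{it}\Big|^p\,dt\Big)^{1/p};$$ its elements are identified with Dirichlet series $\sum_{n\ge1}a_nn^{-s}$, the coefficient functionals being extended by continuity from the Dirichlet polynomials. Let $\mathcal H^\infty$ be the space of Dirichlet series that define a bounded holomorphic function on $\mathbb C_0$ (that is, that converge in some half-plane to a function which extends to a bounded holomorphic function on $\mathbb C_0$). Let $D\in\mathcal H^\infty$ be a non-zero Dirichlet series. Then multiplication of Dirichlet series by $D$ defines a bounded operator $M_D:\mathcal H^p\to\mathcal H^p$, $f\mapsto Df$, and $$\sigma_c(M_D)\subset\overline{D(\mathbb C_0)}\setminus D(\mathbb C_0),$$ where the continuous spectrum $\sigma_c(M_D)$ is the set of all $\lambda\in\mathbb C$ such that $M_D-\lambda$ is injective and has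 a range that is dense but not closed. -/

import Mathlib

open MeasureTheory Filter Topology

noncomputable section

namespace DirichletHardy

/-! ### Means along the imaginary axis -/

/-- The mean `(1 / 2T) ∫_{-T}^{T} f(t) dt`. -/
def mean {E : Type*} [NormedAddCommGroup E] [NormedSpace ℝ E] (f : ℝ → E) (T : ℝ) : E :=
  (2 * T)⁻¹ • ∫ t in (-T)..T, f t

/-- The Dirichlet polynomial `∑ aₙ n⁻ˢ` with coefficients `P`, on the imaginary axis:
`t ↦ ∑ aₙ n^{it}`. -/
def evalIm (P : ℕ+ →₀ ℂ) (t : ℝ) : ℂ :=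
  P.sum fun n c => c * ((n : ℕ) : ℂ) ^ (Complex.I * t)

/-- The `p`-norm of a Dirichlet polynomial:
`‖P‖_p^p = lim_{T → ∞} (1 / 2T) ∫_{-T}^{T} |∑ aₙ n^{it}|^p dt`. -/
def polyNorm (p : ℝ) (P : ℕ+ →₀ ℂ) : ℝ :=
  (limUnder atTop (mean fun t => ‖evalIm P t‖ ^ p)) ^ (1 / p)

/-! Auxiliary facts: the limit defining the norm exists, and it is a norm. -/

/-- The character `t ↦ e^{ilt}`. -/
def expo (l : ℝ) (t : ℝ) : ℂ := Complex.exp ((l * Complex.I) * t)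

theorem continuous_expo (l : ℝ) : Continuous (expo l) := by
  unfold expo; fun_prop

theorem expo_zero : expo 0 = 1 := by
  funext t; simp [expo]

theorem expo_mul (l m : ℝ) : expo l * expo m = expo (l + m) := by
  funext t
  simp only [expo, Pi.mul_apply, ← Complex.exp_add]
  congr 1; push_cast; ring

theorem norm_expo (l t : ℝ) : ‖expo l t‖ = 1 := by
  have : expo l t = Complex.exp (((l * t : ℝ) : ℂ) * Complex.I) := by
    simp only [expo]; congr 1; push_cast; ring
  rw [this, Complex.norm_exp_ofReal_mul_I]

theorem tendsto_mean_expo (l : ℝ) :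
    Tendsto (mean (expo l)) atTop (𝓝 (if l = 0 then 1 else 0)) := by
  split_ifs with h
  · subst h
    refine tendsto_const_nhds.congr' ?_
    filter_upwards [eventually_gt_atTop 0] with T hT
    simp only [mean, expo_zero, Pi.one_apply, intervalIntegral.integral_const, smul_smul]
    rw [show (2 * T)⁻¹ * (T - -T) = 1 by field_simp; ring, one_smul]
  · have hc : ((l : ℂ) * Complex.I) ≠ 0 := by simp [h]
    rw [tendsto_zero_iff_norm_tendsto_zero]
    have hlim : Tendsto (fun T : ℝ => (2 * T)⁻¹ * (2 / |l|)) atTop (𝓝 0) := by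
      have : Tendsto (fun T : ℝ => (2 * T)⁻¹) atTop (𝓝 0) :=
        tendsto_inv_atTop_zero.comp (tendsto_id.const_mul_atTop two_pos)
      simpa using this.mul_const (2 / |l|)
    refine squeeze_zero' (Eventually.of_forall fun _ => norm_nonneg _) ?_ hlim
    filter_upwards [eventually_gt_atTop 0] with T hT
    have hT' : (0 : ℝ) ≤ (2 * T)⁻¹ := by positivity
    simp only [mean, norm_smul, Real.norm_of_nonneg hT']
    refine mul_le_mul_of_nonneg_left ?_ hT'
    have := integral_exp_mul_complex (a := -T) (b := T) hc
    simp only [expo]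
    rw [this, norm_div]
    have h1 := norm_expo l T
    have h2 := norm_expo l (-T)
    simp only [expo] at h1 h2
    have h3 : ‖(l : ℂ) * Complex.I‖ = |l| := by simp
    rw [h3]
    gcongr
    refine (norm_sub_le _ _).trans ?_
    rw [h1, h2]; norm_num

/-- Trigonometric polynomials, as a subalgebra. -/
def trigPoly : Subalgebra ℂ (ℝ → ℂ) := Algebra.adjoin ℂ (Set.range expo)

theorem mean_add {E : Type*} [NormedAddCommGroup E] [NormedSpace ℝ E] {f g : ℝ → E}
    (hf : Continuous f) (hg : Continuous g) : mean (f + g) = mean f + mean g := by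
  funext T
  simp only [mean, Pi.add_apply]
  rw [intervalIntegral.integral_add (hf.intervalIntegrable _ _) (hg.intervalIntegrable _ _),
    smul_add]

theorem mean_const_mul (c : ℂ) (f : ℝ → ℂ) (T : ℝ) :
    mean (fun t => c * f t) T = c * mean f T := by
  simp only [mean, intervalIntegral.integral_const_mul]
  rw [mul_smul_comm]

theorem expo_mem (l : ℝ) : expo l ∈ trigPoly := Algebra.subset_adjoin (Set.mem_range_self l)

theorem span_le_trigPoly :
    Submodule.span ℂ (Set.range expo) ≤ Subalgebra.toSubmodule trigPoly := by
  rw [Submodule.span_le]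
  rintro _ ⟨l, rfl⟩
  exact expo_mem l

theorem trigPoly_mean {f : ℝ → ℂ} (hf : f ∈ trigPoly) :
    Continuous f ∧ ∃ L, Tendsto (mean f) atTop (𝓝 L) := by
  have hcl : (Submonoid.closure (Set.range expo) : Set (ℝ → ℂ)) ⊆ Set.range expo := by
    intro g hg
    induction hg using Submonoid.closure_induction with
    | mem x hx => exact hx
    | one => exact ⟨0, expo_zero⟩
    | mul x y _ _ hx hy =>
      obtain ⟨l, rfl⟩ := hx
      obtain ⟨m, rfl⟩ := hy
      exact ⟨l + m, (expo_mul l m).symm⟩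
  have h : f ∈ Submodule.span ℂ (Set.range expo) := by
    have : f ∈ Subalgebra.toSubmodule trigPoly := hf
    rw [trigPoly, Algebra.adjoin_eq_span] at this
    exact Submodule.span_mono hcl this
  induction h using Submodule.span_induction with
  | mem x hx =>
    obtain ⟨l, rfl⟩ := hx
    exact ⟨continuous_expo l, _, tendsto_mean_expo l⟩
  | zero =>
    refine ⟨continuous_const, 0, ?_⟩
    have : mean (0 : ℝ → ℂ) = fun _ => 0 := by funext T; simp [mean]
    rw [this]; exact tendsto_const_nhds
  | add x y hx hy h1 h2 =>
    have hm : ∀ z ∈ Submodule.span ℂ (Set.range expo), z ∈ trigPoly := by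
      intro z hz
      exact span_le_trigPoly hz
    obtain ⟨c1, L1, l1⟩ := h1 (hm x hx)
    obtain ⟨c2, L2, l2⟩ := h2 (hm y hy)
    exact ⟨c1.add c2, L1 + L2, by rw [mean_add c1 c2]; exact l1.add l2⟩
  | smul a x hx h1 =>
    have hm : ∀ z ∈ Submodule.span ℂ (Set.range expo), z ∈ trigPoly := by
      intro z hz
      exact span_le_trigPoly hz
    obtain ⟨c1, L1, l1⟩ := h1 (hm x hx)
    refine ⟨c1.const_smul a, a * L1, ?_⟩
    have : mean (a • x) = fun T => a * mean x T := by
      funext T; exact mean_const_mul a x T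
    rw [this]; exact l1.const_mul a

theorem natCast_cpow (n : ℕ+) (t : ℝ) :
    ((n : ℕ) : ℂ) ^ (Complex.I * t) = expo (Real.log (n : ℕ)) t := by
  have hn : ((n : ℕ) : ℂ) ≠ 0 := by exact_mod_cast n.ne_zero
  rw [Complex.cpow_def_of_ne_zero hn, expo, Complex.natCast_log]
  congr 1; ring

theorem evalIm_eq (P : ℕ+ →₀ ℂ) :
    evalIm P = ∑ n ∈ P.support, P n • expo (Real.log (n : ℕ)) := by
  funext t
  simp [evalIm, Finsupp.sum, natCast_cpow]

theorem evalIm_mem (P : ℕ+ →₀ ℂ) : evalIm P ∈ trigPoly := by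
  rw [evalIm_eq]
  exact Subalgebra.sum_mem _ fun n _ =>
    Subalgebra.smul_mem _ (expo_mem _) _

theorem star_evalIm_mem (P : ℕ+ →₀ ℂ) : star (evalIm P) ∈ trigPoly := by
  have : star (evalIm P) = ∑ n ∈ P.support, star (P n) • expo (-Real.log (n : ℕ)) := by
    rw [evalIm_eq, star_sum]
    refine Finset.sum_congr rfl fun n _ => ?_
    funext t
    simp only [expo, Pi.star_apply, Pi.smul_apply, smul_eq_mul, ← starRingEnd_apply,
      ← Complex.exp_conj, map_mul, Complex.conj_ofReal, Complex.conj_I]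
    congr 2; push_cast; ring
  rw [this]
  exact Subalgebra.sum_mem _ fun n _ =>
    Subalgebra.smul_mem _ (expo_mem _) _

theorem continuous_evalIm (P : ℕ+ →₀ ℂ) : Continuous (evalIm P) :=
  (trigPoly_mean (evalIm_mem P)).1

theorem evalIm_add (P Q : ℕ+ →₀ ℂ) : evalIm (P + Q) = evalIm P + evalIm Q := by
  funext t
  exact Finsupp.sum_add_index' (by simp) (by intros; ring)

theorem evalIm_smul (c : ℂ) (P : ℕ+ →₀ ℂ) : evalIm (c • P) = fun t => c * evalIm P t := by
  funext t
  simp only [evalIm]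
  rw [Finsupp.sum_smul_index' (by simp), Finsupp.mul_sum]
  simp [mul_assoc]

theorem norm_evalIm_le (P : ℕ+ →₀ ℂ) (t : ℝ) : ‖evalIm P t‖ ≤ ∑ n ∈ P.support, ‖P n‖ := by
  rw [evalIm_eq, Finset.sum_apply]
  refine (norm_sum_le _ _).trans (Finset.sum_le_sum fun n _ => ?_)
  simp [norm_expo]

theorem dist_mean_le {E : Type*} [NormedAddCommGroup E] [NormedSpace ℝ E] {f g : ℝ → E}
    (hf : Continuous f) (hg : Continuous g) {ε : ℝ} (h : ∀ t, ‖f t - g t‖ ≤ ε) {T : ℝ}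
    (hT : 0 < T) : dist (mean f T) (mean g T) ≤ ε := by
  have hT' : (0 : ℝ) ≤ (2 * T)⁻¹ := by positivity
  simp only [mean, dist_eq_norm]
  rw [← smul_sub, ← intervalIntegral.integral_sub (hf.intervalIntegrable _ _)
    (hg.intervalIntegrable _ _), norm_smul, Real.norm_of_nonneg hT']
  have := intervalIntegral.norm_integral_le_of_norm_le_const (a := -T) (b := T)
    (f := fun t => f t - g t) (fun t _ => h t)
  calc _ ≤ (2 * T)⁻¹ * (ε * |T - -T|) := mul_le_mul_of_nonneg_left this hT'
    _ = ε := by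
      rw [show T - -T = 2 * T by ring, abs_of_pos (by positivity)]; field_simp

theorem mean_re (f : ℝ → ℂ) (hf : Continuous f) (T : ℝ) :
    mean (fun t => (f t).re) T = (mean f T).re := by
  simp only [mean, Complex.smul_re]
  congr 1
  exact intervalIntegral.intervalIntegral_re (𝕜 := ℂ) (hf.intervalIntegrable _ _)

/-- The limit in the definition of the norm exists. -/
theorem exists_tendsto_mean {p : ℝ} (hp : 1 ≤ p) (P : ℕ+ →₀ ℂ) :
    ∃ L, Tendsto (mean fun t => ‖evalIm P t‖ ^ p) atTop (𝓝 L) := by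
  set R := ∑ n ∈ P.support, ‖P n‖
  have hcont : Continuous fun t => ‖evalIm P t‖ ^ p :=
    (continuous_evalIm P).norm.rpow_const fun _ => Or.inr (by linarith)
  refine cauchySeq_tendsto_of_complete ?_
  rw [Metric.cauchySeq_iff]
  intro ε hε
  obtain ⟨q, hq⟩ := exists_polynomial_near_of_continuousOn 0 (R ^ 2) (fun x => x ^ (p / 2))
    ((Real.continuous_rpow_const (by linarith)).continuousOn) (ε / 4) (by linarith)
  set w : ℝ → ℂ := evalIm P * star (evalIm P)
  have hw : w ∈ trigPoly := Subalgebra.mul_mem _ (evalIm_mem P) (star_evalIm_mem P)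
  set g : ℝ → ℂ := Polynomial.aeval w (q.map (algebraMap ℝ ℂ))
  have hg : g ∈ trigPoly := by
    have := (Polynomial.aeval (⟨w, hw⟩ : trigPoly) (q.map (algebraMap ℝ ℂ))).2
    rwa [Polynomial.aeval_subalgebra_coe] at this
  obtain ⟨gc, L, hL⟩ := trigPoly_mean hg
  have hgv : ∀ t, (g t).re = q.eval (‖evalIm P t‖ ^ 2) := by
    intro t
    have h1 : g t = Polynomial.aeval (w t) (q.map (algebraMap ℝ ℂ)) :=
      (Polynomial.aeval_algHom_apply (Pi.evalAlgHom ℂ (fun _ : ℝ => ℂ) t) w _).symm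
    have h2 : w t = ((‖evalIm P t‖ ^ 2 : ℝ) : ℂ) := by
      simp only [w, Pi.mul_apply, Pi.star_apply]
      rw [← starRingEnd_apply, Complex.mul_conj, Complex.normSq_eq_norm_sq]
    rw [h1, h2, Polynomial.aeval_map_algebraMap]
    have := Polynomial.aeval_algebraMap_apply ℂ (‖evalIm P t‖ ^ 2) q
    rw [Complex.coe_algebraMap] at this
    rw [this]; simp
  have hclose : ∀ t, ‖‖evalIm P t‖ ^ p - (g t).re‖ ≤ ε / 4 := by
    intro t
    have hmem : ‖evalIm P t‖ ^ 2 ∈ Set.Icc 0 (R ^ 2) :=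
      ⟨by positivity, by gcongr; exact norm_evalIm_le P t⟩
    have h1 := hq _ hmem
    have h2 : (‖evalIm P t‖ ^ 2) ^ (p / 2) = ‖evalIm P t‖ ^ p := by
      rw [← Real.rpow_natCast, ← Real.rpow_mul (norm_nonneg _)]
      congr 1; push_cast; ring
    rw [hgv, Real.norm_eq_abs, abs_sub_comm, ← h2]
    exact h1.le
  have hre : Tendsto (mean fun t => (g t).re) atTop (𝓝 L.re) := by
    have : (mean fun t => (g t).re) = fun T => (mean g T).re := by
      funext T; exact mean_re g gc T
    rw [this]; exact (Complex.continuous_re.tendsto L).comp hL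
  obtain ⟨N, hN⟩ := Metric.cauchySeq_iff.1 hre.cauchySeq (ε / 4) (by linarith)
  refine ⟨max N 1, fun m hm n hn => ?_⟩
  have hm0 : 0 < m := lt_of_lt_of_le one_pos ((le_max_right _ _).trans hm)
  have hn0 : 0 < n := lt_of_lt_of_le one_pos ((le_max_right _ _).trans hn)
  have a1 := dist_mean_le hcont (Complex.continuous_re.comp gc) hclose hm0
  have a2 := dist_mean_le hcont (Complex.continuous_re.comp gc) hclose hn0
  have a3 := hN m ((le_max_left _ _).trans hm) n ((le_max_left _ _).trans hn)
  have a4 := dist_triangle4 (mean (fun t => ‖evalIm P t‖ ^ p) m)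
    (mean (fun t => (g t).re) m) (mean (fun t => (g t).re) n)
    (mean (fun t => ‖evalIm P t‖ ^ p) n)
  rw [dist_comm] at a2
  simp only [Function.comp_def] at a1 a2
  linarith

/-- The uniform probability measure on `(-T, T]`. -/
def unif (T : ℝ) : Measure ℝ :=
  ENNReal.ofReal (2 * T)⁻¹ • volume.restrict (Set.Ioc (-T) T)

theorem unif_prob {T : ℝ} (hT : 0 < T) : IsProbabilityMeasure (unif T) := by
  constructor
  simp only [unif, Measure.smul_apply, Measure.restrict_apply_univ, Real.volume_Ioc, smul_eq_mul]
  rw [← ENNReal.ofReal_mul (by positivity), show (2 * T)⁻¹ * (T - -T) = 1 by field_simp; ring]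
  simp

theorem integral_unif {E : Type*} [NormedAddCommGroup E] [NormedSpace ℝ E] (f : ℝ → E)
    {T : ℝ} (hT : 0 < T) : ∫ t, f t ∂(unif T) = mean f T := by
  rw [unif, integral_smul_measure, mean, intervalIntegral.integral_of_le (by linarith),
    ENNReal.toReal_ofReal (by positivity)]

theorem memLp_evalIm (P : ℕ+ →₀ ℂ) (q : ENNReal) {T : ℝ} (hT : 0 < T) :
    MemLp (evalIm P) q (unif T) := by
  have := unif_prob hT
  exact MemLp.of_bound (continuous_evalIm P).aestronglyMeasurable _
    (Eventually.of_forall (norm_evalIm_le P))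

theorem lpNorm_evalIm {p : ℝ} (hp : 1 ≤ p) (P : ℕ+ →₀ ℂ) {T : ℝ} (hT : 0 < T) :
    lpNorm (evalIm P) (ENNReal.ofReal p) (unif T)
      = (mean (fun t => ‖evalIm P t‖ ^ p) T) ^ (1 / p) := by
  have h0 : ENNReal.ofReal p ≠ 0 := by simp; linarith
  rw [lpNorm_eq_integral_norm_rpow_toReal h0 ENNReal.ofReal_ne_top
    (continuous_evalIm P).aestronglyMeasurable, ENNReal.toReal_ofReal (by linarith),
    integral_unif _ hT, one_div]

/-- The norm is the limit of the `L^p` norms over `(-T, T]`. -/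
theorem tendsto_lpNorm {p : ℝ} (hp : 1 ≤ p) (P : ℕ+ →₀ ℂ) :
    Tendsto (fun T => lpNorm (evalIm P) (ENNReal.ofReal p) (unif T)) atTop
      (𝓝 (polyNorm p P)) := by
  have h := tendsto_nhds_limUnder (exists_tendsto_mean hp P)
  have h2 := h.rpow_const (p := 1 / p) (Or.inr (by positivity))
  refine h2.congr' ?_
  filter_upwards [eventually_gt_atTop 0] with T hT
  exact (lpNorm_evalIm hp P hT).symm

theorem tendsto_mean_coeff (P : ℕ+ →₀ ℂ) (m : ℕ+) :
    Tendsto (mean fun t => expo (-Real.log (m : ℕ)) t * evalIm P t) atTop (𝓝 (P m)) := by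
  have key : ∀ T, mean (fun t => expo (-Real.log (m : ℕ)) t * evalIm P t) T =
      ∑ n ∈ P.support, P n * mean (expo (Real.log (n : ℕ) - Real.log (m : ℕ))) T := by
    intro T
    have h1 : (fun t => expo (-Real.log (m : ℕ)) t * evalIm P t) =
        fun t => ∑ n ∈ P.support, P n * expo (Real.log (n : ℕ) - Real.log (m : ℕ)) t := by
      funext t
      rw [evalIm_eq, Finset.sum_apply, Finset.mul_sum]
      refine Finset.sum_congr rfl fun n _ => ?_
      have := congrFun (expo_mul (Real.log (n : ℕ)) (-Real.log (m : ℕ))) t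
      simp only [Pi.mul_apply] at this
      rw [sub_eq_add_neg, ← this]
      simp only [Pi.smul_apply, smul_eq_mul]; ring
    rw [h1]
    simp only [mean]
    rw [intervalIntegral.integral_finsetSum fun n _ =>
      ((continuous_expo _).intervalIntegrable _ _).const_mul _, Finset.smul_sum]
    refine Finset.sum_congr rfl fun n _ => ?_
    exact mean_const_mul (P n) _ T
  rw [show (mean fun t => expo (-Real.log (m : ℕ)) t * evalIm P t) = _ from funext key]
  have h2 := tendsto_finsetSum P.support fun n _ =>
    (tendsto_mean_expo (Real.log (n : ℕ) - Real.log (m : ℕ))).const_mul (P n)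
  convert h2 using 2
  have h3 : ∀ n : ℕ+, Real.log (n : ℕ) - Real.log (m : ℕ) = 0 ↔ n = m := by
    intro n
    rw [sub_eq_zero]
    constructor
    · intro h
      have := Real.log_injOn_pos (Set.mem_Ioi.2 (by exact_mod_cast n.pos))
        (Set.mem_Ioi.2 (by exact_mod_cast m.pos)) h
      exact PNat.eq (by exact_mod_cast this)
    · rintro rfl; rfl
  simp only [h3]
  simp [eq_comm]

theorem norm_coeff_le {p : ℝ} (hp : 1 ≤ p) (P : ℕ+ →₀ ℂ) (m : ℕ+) : ‖P m‖ ≤ polyNorm p P := by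
  refine le_of_tendsto_of_tendsto (tendsto_mean_coeff P m).norm (tendsto_lpNorm hp P) ?_
  filter_upwards [eventually_gt_atTop 0] with T hT
  have := unif_prob hT
  rw [← integral_unif _ hT]
  refine (norm_integral_le_integral_norm _).trans ?_
  simp only [norm_mul, norm_expo, one_mul]
  rw [← lpNorm_one_eq_integral_norm (continuous_evalIm P).aestronglyMeasurable,
    ← toReal_eLpNorm (continuous_evalIm P).aestronglyMeasurable,
    ← toReal_eLpNorm (continuous_evalIm P).aestronglyMeasurable]
  refine ENNReal.toReal_mono (memLp_evalIm P _ hT).eLpNorm_ne_top ?_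
  exact eLpNorm_le_eLpNorm_of_exponent_le (by simpa using hp)
    (continuous_evalIm P).aestronglyMeasurable

theorem polyNorm_smul {p : ℝ} (hp : 1 ≤ p) (c : ℂ) (P : ℕ+ →₀ ℂ) :
    polyNorm p (c • P) = ‖c‖ * polyNorm p P := by
  refine tendsto_nhds_unique (tendsto_lpNorm hp (c • P)) ?_
  refine ((tendsto_lpNorm hp P).const_mul ‖c‖).congr fun T => ?_
  rw [evalIm_smul]
  exact (lpNorm_const_smul c (evalIm P) (unif T)).symm

theorem polyNorm_add_le {p : ℝ} (hp : 1 ≤ p) (P Q : ℕ+ →₀ ℂ) :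
    polyNorm p (P + Q) ≤ polyNorm p P + polyNorm p Q := by
  refine le_of_tendsto_of_tendsto (tendsto_lpNorm hp (P + Q))
    ((tendsto_lpNorm hp P).add (tendsto_lpNorm hp Q)) ?_
  filter_upwards [eventually_gt_atTop 0] with T hT
  rw [evalIm_add]
  exact lpNorm_add_le (memLp_evalIm P _ hT) (by simpa using hp)

theorem polyNorm_eq_zero_iff {p : ℝ} (hp : 1 ≤ p) (P : ℕ+ →₀ ℂ) : polyNorm p P = 0 ↔ P = 0 := by
  constructor
  · intro h
    ext m
    exact norm_le_zero_iff.1 ((norm_coeff_le hp P m).trans h.le)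
  · rintro rfl
    refine tendsto_nhds_unique (tendsto_lpNorm hp 0) ?_
    have : evalIm 0 = 0 := by funext t; simp [evalIm]
    rw [this]; simp

/-! ### The Hardy space `ℋ^p` -/

/-- The space of Dirichlet polynomials, to be normed by the `p`-norm. -/
def DirichletPoly (_p : ℝ) : Type := ℕ+ →₀ ℂ

instance (p : ℝ) : AddCommGroup (DirichletPoly p) := inferInstanceAs (AddCommGroup (ℕ+ →₀ ℂ))

instance (p : ℝ) : Module ℂ (DirichletPoly p) := inferInstanceAs (Module ℂ (ℕ+ →₀ ℂ))

/-- The coefficients of a Dirichlet polynomial. -/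
def toFinsupp (p : ℝ) : DirichletPoly p ≃ₗ[ℂ] (ℕ+ →₀ ℂ) := LinearEquiv.refl ℂ (ℕ+ →₀ ℂ)

instance (p : ℝ) : Norm (DirichletPoly p) := ⟨fun P => polyNorm p (toFinsupp p P)⟩

theorem normCore (p : ℝ) [hp : Fact (1 ≤ p)] : NormedSpace.Core ℂ (DirichletPoly p) where
  norm_nonneg P := (norm_nonneg _).trans (norm_coeff_le hp.out (toFinsupp p P) 1)
  norm_smul c P := polyNorm_smul hp.out c (toFinsupp p P)
  norm_triangle P Q := polyNorm_add_le hp.out (toFinsupp p P) (toFinsupp p Q)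
  norm_eq_zero_iff P := polyNorm_eq_zero_iff hp.out (toFinsupp p P)

instance (p : ℝ) [Fact (1 ≤ p)] : NormedAddCommGroup (DirichletPoly p) :=
  NormedAddCommGroup.ofCore (normCore p)

instance (p : ℝ) [Fact (1 ≤ p)] : NormedSpace ℂ (DirichletPoly p) :=
  NormedSpace.ofCore (normCore p)

/-- The Hardy space `ℋ^p`: the completion of the Dirichlet polynomials under the `p`-norm. -/
abbrev Hardy (p : ℝ) [Fact (1 ≤ p)] : Type := UniformSpace.Completion (DirichletPoly p)

/-- The `n`-th coefficient of a Dirichlet polynomial, a functional of norm at most `1`. -/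
def polyCoeff (p : ℝ) [hp : Fact (1 ≤ p)] (n : ℕ+) : DirichletPoly p →L[ℂ] ℂ :=
  (Finsupp.lapply n ∘ₗ (toFinsupp p).toLinearMap).mkContinuous 1
    fun P => by rw [one_mul]; exact norm_coeff_le hp.out (toFinsupp p P) n

/-- The coefficients of an element of `ℋ^p`: each coefficient functional is extended by
continuity from the Dirichlet polynomials. The (formal) Dirichlet series `∑ aₙ n⁻ˢ` is encoded
by the arithmetic function `n ↦ aₙ`. -/
def coeffs {p : ℝ} [Fact (1 ≤ p)] (f : Hardy p) : ArithmeticFunction ℂ where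
  toFun n := if h : 0 < n then (polyCoeff p ⟨n, h⟩).fromCompletion f else 0
  map_zero' := by simp

/-! ### `ℋ^∞`, multiplication operators, continuous spectrum -/

/-- The half-plane `ℂ_a = {s : Re s > a}`. -/
def halfPlane (a : ℝ) : Set ℂ := {s | a < s.re}

/-- The Dirichlet series `∑ aₙ n⁻ˢ` belongs to `ℋ^∞`, and `D` is the bounded holomorphic function
that it defines on `ℂ_0`: `D` is holomorphic and bounded on `ℂ_0`, and is the sum of the series in
some half-plane. (A Dirichlet series that converges at a point converges absolutely in a smaller
half-plane, hence `LSeriesHasSum`; by Bohr's theorem the series then converges to `D` on all of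
`ℂ_0`.) -/
structure MemHardyInfty (a : ArithmeticFunction ℂ) (D : ℂ → ℂ) : Prop where
  holo : DifferentiableOn ℂ D (halfPlane 0)
  bounded : ∃ C : ℝ, ∀ s ∈ halfPlane 0, ‖D s‖ ≤ C
  series : ∃ σ : ℝ, 0 ≤ σ ∧ ∀ s ∈ halfPlane σ, LSeriesHasSum a s (D s)

/-- `M` is the operator `f ↦ D f` on `ℋ^p`, where `D = ∑ aₙ n⁻ˢ`. The product of Dirichlet series
is the one of `ArithmeticFunction`, i.e. `(∑ aₙ n⁻ˢ)(∑ bₙ n⁻ˢ) = ∑ₙ (∑_{kl = n} a_k b_l) n⁻ˢ`. -/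
def IsMultiplication {p : ℝ} [Fact (1 ≤ p)] (a : ArithmeticFunction ℂ)
    (M : Hardy p →L[ℂ] Hardy p) : Prop :=
  ∀ f, coeffs (M f) = a * coeffs f

/-- The continuous spectrum of `T`: those `λ` for which `T - λ` is injective and has a range that
is dense but not closed. -/
def continuousSpectrum {X : Type*} [NormedAddCommGroup X] [NormedSpace ℂ X] (T : X →L[ℂ] X) :
    Set ℂ :=
  {l | Function.Injective (T - l • ContinuousLinearMap.id ℂ X) ∧
    DenseRange (T - l • ContinuousLinearMap.id ℂ X) ∧
    ¬ IsClosed (Set.range (T - l • ContinuousLinearMap.id ℂ X))}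

end DirichletHardy

end

open MeasureTheory Filter Topology

noncomputable section

namespace DirichletHardy

/-! ### Operations on Dirichlet polynomials -/

/-! Subtracting `λ` from `D` changes only the first coefficient, so it is enough to treat `λ = 0`.
If `|D| ≥ δ > 0` on `ℂ_0`, then `1/D` is again the sum of a Dirichlet series in `ℋ^∞`
(`MemHardyInfty.exists_inv`). Multiplication by it gives preimages, so the range is everything and
in particular closed. If `D` vanishes at `s₀ ∈ ℂ_0`, the range must be shown not to be dense. A
functional that kills it is needed, but evaluation at `s₀` is unbounded on `ℋ^p` when `Re s₀ ≤ 1/2`.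

The remedy is to keep only the integers whose prime factors are at most `N`. This operation is
multiplicative. Evaluating the smooth part of `f` at any point of `ℂ_0` is bounded on `ℋ^p`, because
the coefficients are bounded by `‖f‖` and `∑ n^{-σ}` over smooth `n` converges for every `σ > 0`.
The smooth parts of `D` converge to `D` uniformly on closed vertical strips of finite width in `ℂ_0`
(`tendstoUniformlyOn_smoothPart`, by the three lines theorem), so by a Hurwitz argument one of them
has a zero in `ℂ_0` (`exists_zero_smoothPart`). The evaluation there annihilates the range but takes
the value `1` at the constant `1`.

The analytic tool throughout is a Fejér-type kernel, `|∑_{m ∣ Q} m^{it}|²` divided by the number of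
divisors of `Q`. It is nonnegative with mean `1`, so averaging against it preserves bounds, and it
turns a Dirichlet series into a polynomial with coefficients `wt Q n * aₙ`. With `Q = (k!)^k` the
weights tend to `1`. This gives square summability of the coefficients of `D`, the multiplication
operator as a limit of polynomial ones, and the fact that elements of `ℋ^p` are determined by their
coefficients. With `Q = (N!)^k` and `N` fixed, the weights tend to the indicator of the smooth
numbers, so smooth parts inherit the bound of `D` (`norm_lseries_smoothPart_le`). -/

theorem evalIm_single (n : ℕ+) (c : ℂ) (t : ℝ) :
    evalIm (Finsupp.single n c) t = c * expo (Real.log (n : ℕ)) t := by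
  simp [evalIm, natCast_cpow]

/-- Evaluation of Dirichlet polynomials at a point of the imaginary axis, as a linear map. -/
def evalImLin (t : ℝ) : (ℕ+ →₀ ℂ) →ₗ[ℂ] ℂ where
  toFun P := evalIm P t
  map_add' P Q := congrFun (evalIm_add P Q) t
  map_smul' c P := congrFun (evalIm_smul c P) t

theorem evalImLin_apply (t : ℝ) (P : ℕ+ →₀ ℂ) : evalImLin t P = evalIm P t := rfl

/-- Multiplication of the `n`-th coefficient by `w n`. -/
def scale (w : ℕ+ → ℂ) : (ℕ+ →₀ ℂ) →ₗ[ℂ] (ℕ+ →₀ ℂ) :=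
  Finsupp.linearCombination ℂ fun n => Finsupp.single n (w n)

theorem scale_single (w : ℕ+ → ℂ) (n : ℕ+) (c : ℂ) :
    scale w (Finsupp.single n c) = Finsupp.single n (c * w n) := by
  simp [scale]

theorem scale_apply (w : ℕ+ → ℂ) (P : ℕ+ →₀ ℂ) (n : ℕ+) : scale w P n = P n * w n := by
  induction P using Finsupp.induction_linear with
  | zero => simp
  | add f g hf hg => simp [hf, hg, add_mul]
  | single m c =>
    rw [scale_single]
    by_cases h : m = n
    · subst h; simp
    · simp [h]

/-- The product of Dirichlet polynomials, linear in the second factor. -/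
def polyMul (A : ℕ+ →₀ ℂ) : (ℕ+ →₀ ℂ) →ₗ[ℂ] (ℕ+ →₀ ℂ) :=
  Finsupp.linearCombination ℂ fun m => A.mapDomain (· * m)

theorem polyMul_single (A : ℕ+ →₀ ℂ) (m : ℕ+) (c : ℂ) :
    polyMul A (Finsupp.single m c) = c • A.mapDomain (· * m) := by
  simp [polyMul]

theorem polyMul_sub (A B P : ℕ+ →₀ ℂ) : polyMul (A - B) P = polyMul A P - polyMul B P := by
  induction P using Finsupp.induction_linear with
  | zero => simp
  | add f g hf hg => simp only [map_add, hf, hg]; abel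
  | single m c =>
    simp only [polyMul_single, sub_eq_add_neg, Finsupp.mapDomain_add, smul_add]
    congr 1
    have := (Finsupp.mapDomain.addMonoidHom (M := ℂ) (· * m)).map_neg B
    simp only [Finsupp.mapDomain.addMonoidHom_apply] at this
    rw [this, smul_neg]

theorem evalIm_mapDomain_mul (A : ℕ+ →₀ ℂ) (m : ℕ+) (t : ℝ) :
    evalIm (A.mapDomain (· * m)) t = evalIm A t * expo (Real.log (m : ℕ)) t := by
  have hlog : ∀ n : ℕ+, expo (Real.log ((n * m : ℕ+) : ℕ)) t
      = expo (Real.log (n : ℕ)) t * expo (Real.log (m : ℕ)) t := by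
    intro n
    rw [← Pi.mul_apply, expo_mul, PNat.mul_coe, Nat.cast_mul, Real.log_mul
      (by exact_mod_cast n.ne_zero) (by exact_mod_cast m.ne_zero)]
  simp only [← evalImLin_apply]
  induction A using Finsupp.induction_linear with
  | zero => simp
  | add f g hf hg => rw [Finsupp.mapDomain_add, map_add, map_add, hf, hg, add_mul]
  | single n c =>
    simp only [Finsupp.mapDomain_single, evalImLin_apply, evalIm_single, hlog]
    ring

theorem evalIm_polyMul (A P : ℕ+ →₀ ℂ) (t : ℝ) :
    evalIm (polyMul A P) t = evalIm A t * evalIm P t := by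
  simp only [← evalImLin_apply]
  induction P using Finsupp.induction_linear with
  | zero => simp
  | add f g hf hg => rw [map_add, map_add, map_add, hf, hg, mul_add]
  | single m c =>
    simp only [polyMul_single, map_smul, evalImLin_apply, evalIm_single, evalIm_mapDomain_mul,
      smul_eq_mul]
    ring

/-! ### Estimates for the norm -/

theorem tendsto_const_div_atTop (c : ℝ) : Tendsto (fun T : ℝ => (2 * T)⁻¹ * c) atTop (𝓝 0) := by
  have : Tendsto (fun T : ℝ => (2 * T)⁻¹) atTop (𝓝 0) :=
    tendsto_inv_atTop_zero.comp (tendsto_id.const_mul_atTop two_pos)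
  simpa using this.mul_const c

theorem polyNorm_le_mul {p : ℝ} (hp : 1 ≤ p) {P R : ℕ+ →₀ ℂ} {B : ℝ}
    (h : ∀ t, ‖evalIm P t‖ ≤ B * ‖evalIm R t‖) : polyNorm p P ≤ |B| * polyNorm p R := by
  -- Absorbing the constant into `R` makes both sides norms of polynomials, hence limits of `L^p`
  -- norms over the same intervals.
  rw [← Real.norm_eq_abs, ← Complex.norm_real, ← polyNorm_smul hp]
  refine le_of_tendsto_of_tendsto (tendsto_lpNorm hp P) (tendsto_lpNorm hp _) ?_
  filter_upwards [eventually_gt_atTop 0] with T hT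
  refine lpNorm_mono_real (memLp_evalIm _ _ hT).norm ?_ |>.trans_eq (lpNorm_norm
    (continuous_evalIm _).aestronglyMeasurable _)
  intro t
  rw [evalIm_smul, norm_mul, Complex.norm_real, Real.norm_eq_abs]
  exact (h t).trans (mul_le_mul_of_nonneg_right (le_abs_self B) (norm_nonneg _))

theorem norm_mean_le_integral {E : Type*} [NormedAddCommGroup E] [NormedSpace ℝ E] (f : ℝ → E)
    {T : ℝ} (hT : 0 < T) : ‖mean f T‖ ≤ mean (fun t => ‖f t‖) T := by
  simp only [mean, norm_smul, smul_eq_mul]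
  rw [Real.norm_of_nonneg (by positivity)]
  exact mul_le_mul_of_nonneg_left
    (intervalIntegral.norm_integral_le_integral_norm (by linarith)) (by positivity)

theorem mean_mono {f g : ℝ → ℝ} (hf : Continuous f) (hg : Continuous g) (h : ∀ t, f t ≤ g t)
    {T : ℝ} (hT : 0 < T) : mean f T ≤ mean g T := by
  simp only [mean, smul_eq_mul]
  exact mul_le_mul_of_nonneg_left (intervalIntegral.integral_mono_on (by linarith)
    (hf.intervalIntegrable _ _) (hg.intervalIntegrable _ _) fun t _ => h t) (by positivity)

theorem mean_const {E : Type*} [NormedAddCommGroup E] [NormedSpace ℝ E] [CompleteSpace E] (c : E) {T : ℝ}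
    (hT : 0 < T) : mean (fun _ => c) T = c := by
  simp only [mean, intervalIntegral.integral_const, smul_smul]
  rw [show (2 * T)⁻¹ * (T - -T) = 1 by field_simp; ring, one_smul]

theorem mean_sum {ι E : Type*} [NormedAddCommGroup E] [NormedSpace ℝ E] (S : Finset ι)
    {f : ι → ℝ → E} (hf : ∀ i ∈ S, Continuous (f i)) (T : ℝ) :
    mean (fun t => ∑ i ∈ S, f i t) T = ∑ i ∈ S, mean (f i) T := by
  simp only [mean]
  rw [intervalIntegral.integral_finsetSum fun i hi => (hf i hi).intervalIntegrable _ _,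
    Finset.smul_sum]

/-- Moving the window changes the integral only over two intervals of length `|u|`, a bounded amount
that the factor `1/(2T)` kills. -/
theorem tendsto_mean_translate {f : ℝ → ℝ} (hf : Continuous f) {B L : ℝ} (hB : ∀ t, ‖f t‖ ≤ B)
    (h : Tendsto (mean f) atTop (𝓝 L)) (u : ℝ) :
    Tendsto (mean fun t => f (t + u)) atTop (𝓝 L) := by
  have hi : ∀ a b, IntervalIntegrable f volume a b := fun a b => hf.intervalIntegrable a b
  have key : Tendsto (fun T => mean (fun t => f (t + u)) T - mean f T) atTop (𝓝 0) := by
    rw [tendsto_zero_iff_norm_tendsto_zero]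
    refine squeeze_zero' (Eventually.of_forall fun _ => norm_nonneg _) ?_
      (tendsto_const_div_atTop (B * |u| + B * |u|))
    filter_upwards [eventually_gt_atTop 0] with T hT
    simp only [mean]
    rw [intervalIntegral.integral_comp_add_right f u, ← smul_sub,
      intervalIntegral.integral_interval_sub_interval_comm' (hi _ _) (hi _ _) (hi _ _),
      norm_smul, Real.norm_of_nonneg (by positivity : (0 : ℝ) ≤ (2 * T)⁻¹)]
    refine mul_le_mul_of_nonneg_left ((norm_sub_le _ _).trans ?_) (by positivity)
    refine add_le_add ((intervalIntegral.norm_integral_le_of_norm_le_const fun t _ => hB t).trans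
      (le_of_eq ?_)) ((intervalIntegral.norm_integral_le_of_norm_le_const
        fun t _ => hB t).trans (le_of_eq ?_)) <;> congr 2 <;> ring
  simpa using key.add h

theorem evalIm_scale_expo (u : ℝ) (P : ℕ+ →₀ ℂ) (t : ℝ) :
    evalIm (scale (fun n => expo (Real.log (n : ℕ)) u) P) t = evalIm P (t + u) := by
  simp only [← evalImLin_apply]
  induction P using Finsupp.induction_linear with
  | zero => simp
  | add f g hf hg => simp only [map_add, hf, hg]
  | single m c =>
    simp only [scale_single, evalImLin_apply, evalIm_single, expo, mul_assoc, ← Complex.exp_add]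
    congr 2; push_cast; ring

theorem continuous_norm_evalIm_rpow {p : ℝ} (hp : 1 ≤ p) (P : ℕ+ →₀ ℂ) :
    Continuous fun t => ‖evalIm P t‖ ^ p :=
  (continuous_evalIm P).norm.rpow_const fun _ => Or.inr (by linarith)

/-- The norm is invariant under vertical translations. -/
theorem polyNorm_scale_expo {p : ℝ} (hp : 1 ≤ p) (u : ℝ) (P : ℕ+ →₀ ℂ) :
    polyNorm p (scale (fun n => expo (Real.log (n : ℕ)) u) P) = polyNorm p P := by
  obtain ⟨L, hL⟩ := exists_tendsto_mean hp P
  have h2 := tendsto_mean_translate (continuous_norm_evalIm_rpow hp P)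
    (B := (∑ n ∈ P.support, ‖P n‖) ^ p) (fun t => by
      rw [Real.norm_of_nonneg (by positivity)]
      exact Real.rpow_le_rpow (norm_nonneg _) (norm_evalIm_le P t) (by linarith)) hL u
  simp only [polyNorm, evalIm_scale_expo]
  rw [hL.limUnder_eq, h2.limUnder_eq]

/-- Parseval's formula. -/
theorem tendsto_mean_sq (P : ℕ+ →₀ ℂ) :
    Tendsto (mean fun t => ‖evalIm P t‖ ^ 2) atTop (𝓝 (∑ n ∈ P.support, ‖P n‖ ^ 2)) := by
  -- Only the conjugate factor of `|P|² = conj P * P` is expanded, so each term is a mean that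
  -- extracts one coefficient of `P`.
  have h1 : Tendsto (fun T => ∑ n ∈ P.support, star (P n) *
      mean (fun t => expo (-Real.log (n : ℕ)) t * evalIm P t) T) atTop
      (𝓝 (∑ n ∈ P.support, star (P n) * P n)) :=
    tendsto_finsetSum _ fun n _ => (tendsto_mean_coeff P n).const_mul _
  have h2 : ∀ T, (mean (fun t => ‖evalIm P t‖ ^ 2) T) =
      (∑ n ∈ P.support, star (P n) *
        mean (fun t => expo (-Real.log (n : ℕ)) t * evalIm P t) T).re := by
    intro T
    simp only [← mean_const_mul]
    rw [← mean_sum P.support (f := fun n t => star (P n) *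
      (expo (-Real.log (n : ℕ)) t * evalIm P t)) fun n _ => continuous_const.mul
        ((continuous_expo _).mul (continuous_evalIm P)), ← mean_re]
    · congr 1
      funext t
      have h3 : ∑ n ∈ P.support, star (P n) * (expo (-Real.log (n : ℕ)) t * evalIm P t)
          = star (evalIm P t) * evalIm P t := by
        conv_rhs => rw [evalIm_eq]
        rw [Finset.sum_apply, star_sum, Finset.sum_mul]
        refine Finset.sum_congr rfl fun n _ => ?_
        rw [← mul_assoc, evalIm_eq, Finset.sum_apply]
        congr 1
        simp only [expo, Pi.smul_apply, smul_eq_mul, ← starRingEnd_apply,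
          ← Complex.exp_conj, map_mul, Complex.conj_ofReal, Complex.conj_I]
        congr 2; push_cast; ring
      rw [h3, ← starRingEnd_apply, mul_comm, Complex.mul_conj, Complex.normSq_eq_norm_sq,
        Complex.ofReal_re]
    · exact continuous_finsetSum _ fun n _ => continuous_const.mul
        ((continuous_expo _).mul (continuous_evalIm P))
  have h4 := (Complex.continuous_re.tendsto _).comp h1
  convert h4 using 1
  · funext T; exact h2 T
  · congr 1
    rw [Complex.re_sum]
    refine Finset.sum_congr rfl fun n _ => ?_
    rw [← starRingEnd_apply, mul_comm, Complex.mul_conj, Complex.normSq_eq_norm_sq,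
      Complex.ofReal_re]

/-- For uniformly bounded Dirichlet polynomials, convergence to `0` in the `2`-norm implies
convergence to `0` in the `p`-norm. -/
theorem tendsto_polyNorm_zero {p : ℝ} (hp : 1 ≤ p) {ι : Type*} {l : Filter ι} {g : ι → ℕ+ →₀ ℂ}
    {B : ℝ} (hB : ∀ i t, ‖evalIm (g i) t‖ ≤ B)
    (h2 : Tendsto (fun i => ∑ n ∈ (g i).support, ‖g i n‖ ^ 2) l (𝓝 0)) :
    Tendsto (fun i => polyNorm p (g i)) l (𝓝 0) := by
  have hp0 : 0 < p := by linarith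
  choose L hL using fun i => exists_tendsto_mean hp (g i)
  have hLeq : ∀ i, polyNorm p (g i) = L i ^ (1 / p) := fun i => by
    rw [polyNorm, (hL i).limUnder_eq]
  have hL0 : ∀ i, 0 ≤ L i := fun i => by
    refine ge_of_tendsto (hL i) ?_
    filter_upwards [eventually_gt_atTop 0] with T hT
    refine (mean_const (0 : ℝ) hT).ge.trans (mean_mono continuous_const
      (continuous_norm_evalIm_rpow hp _) (fun t => by positivity) hT)
  -- Chebyshev: where `|g| ≤ ε` the first term suffices, and where `|g| ≥ ε` one has `|g|^p ≤ |B|^p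
  -- ≤ |B|^p |g|² / ε²`. Every `p ≥ 1` is thus handled at once.
  have hbd : ∀ i, ∀ ε > 0, L i ≤ ε ^ p + |B| ^ p / ε ^ 2 * ∑ n ∈ (g i).support, ‖g i n‖ ^ 2 := by
    intro i ε hε
    have h3 : Tendsto (fun T => ε ^ p + |B| ^ p / ε ^ 2 * mean (fun t => ‖evalIm (g i) t‖ ^ 2) T)
        atTop (𝓝 (ε ^ p + |B| ^ p / ε ^ 2 * ∑ n ∈ (g i).support, ‖g i n‖ ^ 2)) :=
      ((tendsto_mean_sq (g i)).const_mul _).const_add _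
    refine le_of_tendsto_of_tendsto (hL i) h3 ?_
    filter_upwards [eventually_gt_atTop 0] with T hT
    have hc : Continuous fun t => ‖evalIm (g i) t‖ ^ 2 := (continuous_evalIm _).norm.pow 2
    have h5 : mean (fun t => ε ^ p + |B| ^ p / ε ^ 2 * ‖evalIm (g i) t‖ ^ 2) T =
        ε ^ p + |B| ^ p / ε ^ 2 * mean (fun t => ‖evalIm (g i) t‖ ^ 2) T := by
      have := congrFun (mean_add (f := fun _ : ℝ => ε ^ p)
        (g := fun t => |B| ^ p / ε ^ 2 * ‖evalIm (g i) t‖ ^ 2) continuous_const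
        (hc.const_mul _)) T
      simp only [Pi.add_apply, mean_const _ hT] at this
      refine Eq.trans this ?_
      congr 1
      simp only [mean, intervalIntegral.integral_const_mul, smul_eq_mul]
      ring
    rw [← h5]
    refine mean_mono (continuous_norm_evalIm_rpow hp _) (continuous_const.add (hc.const_mul _))
      (fun t => ?_) hT
    rcases le_total ‖evalIm (g i) t‖ ε with h | h
    · exact (Real.rpow_le_rpow (norm_nonneg _) h hp0.le).trans
        (le_add_of_nonneg_right (by positivity))
    · have h6 : ‖evalIm (g i) t‖ ^ p ≤ |B| ^ p :=
        Real.rpow_le_rpow (norm_nonneg _) ((hB i t).trans (le_abs_self B)) hp0.le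
      have h7 : 1 ≤ ‖evalIm (g i) t‖ ^ 2 / ε ^ 2 := by
        rw [one_le_div (by positivity)]; gcongr
      calc _ ≤ |B| ^ p * 1 := by rw [mul_one]; exact h6
        _ ≤ |B| ^ p * (‖evalIm (g i) t‖ ^ 2 / ε ^ 2) := by gcongr
        _ = |B| ^ p / ε ^ 2 * ‖evalIm (g i) t‖ ^ 2 := by ring
        _ ≤ _ := le_add_of_nonneg_left (by positivity)
  simp only [hLeq]
  have hLt : Tendsto L l (𝓝 0) := by
    rw [Metric.tendsto_nhds]
    intro δ hδ
    set ε : ℝ := (δ / 2) ^ (1 / p) with hεd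
    have hε : 0 < ε := by positivity
    have hεp : ε ^ p = δ / 2 := by
      rw [hεd, ← Real.rpow_mul (by positivity), one_div_mul_cancel hp0.ne', Real.rpow_one]
    have h8 : Tendsto (fun i => ε ^ p + |B| ^ p / ε ^ 2 * ∑ n ∈ (g i).support, ‖g i n‖ ^ 2) l
        (𝓝 (ε ^ p + |B| ^ p / ε ^ 2 * 0)) := (h2.const_mul _).const_add _
    filter_upwards [(tendsto_order.1 h8).2 δ (by rw [hεp]; linarith)] with i hi
    rw [dist_zero_right, Real.norm_of_nonneg (hL0 i)]
    exact (hbd i ε hε).trans_lt hi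
  have := hLt.rpow_const (p := 1 / p) (Or.inr (by positivity))
  rwa [Real.zero_rpow (by positivity)] at this

/-! ### Fejér-type weights attached to the divisors of an integer -/

/-- The proportion of divisors `m` of `Q` for which `n * m` is again a divisor of `Q`. -/
def wt (Q n : ℕ) : ℝ := (Q.divisors.filter fun m => n * m ∣ Q).card / Q.divisors.card

theorem card_divisors_pos {Q : ℕ} (hQ : Q ≠ 0) : (0 : ℝ) < Q.divisors.card := by
  exact_mod_cast Finset.card_pos.2 (Nat.nonempty_divisors.2 hQ)

theorem wt_nonneg (Q n : ℕ) : 0 ≤ wt Q n := by unfold wt; positivity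

theorem wt_le_one (Q n : ℕ) : wt Q n ≤ 1 :=
  div_le_one_of_le₀ (by exact_mod_cast Finset.card_filter_le _ _) (by positivity)

theorem wt_one {Q : ℕ} (hQ : Q ≠ 0) : wt Q 1 = 1 := by
  have : (Q.divisors.filter fun m => 1 * m ∣ Q) = Q.divisors :=
    Finset.filter_true_of_mem fun m hm => by simpa using Nat.dvd_of_mem_divisors hm
  rw [wt, this, div_self (card_divisors_pos hQ).ne']

theorem wt_eq_zero_of_not_dvd {Q n : ℕ} (h : ¬ n ∣ Q) : wt Q n = 0 := by
  have : (Q.divisors.filter fun m => n * m ∣ Q) = ∅ :=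
    Finset.filter_false_of_mem fun m _ hm => h ((Dvd.intro _ rfl).trans hm)
  rw [wt, this]; simp

/-- A divisor `m` that fails for `a * b` either fails for `b`, or `b * m` is a divisor that fails
for `a`; the map `m ↦ b * m` is injective. -/
theorem one_sub_wt_mul_le {Q : ℕ} (hQ : Q ≠ 0) (a : ℕ) {b : ℕ} (hb : b ≠ 0) :
    1 - wt Q (a * b) ≤ (1 - wt Q a) + (1 - wt Q b) := by
  have h0 := card_divisors_pos hQ
  have key : (Q.divisors.filter fun m => b * m ∣ Q).card ≤
      (Q.divisors.filter fun m => a * b * m ∣ Q).card +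
        (Q.divisors.filter fun m => ¬ a * m ∣ Q).card := by
    have hsub : ((Q.divisors.filter fun m => b * m ∣ Q).filter fun m => ¬ a * b * m ∣ Q).card ≤
        (Q.divisors.filter fun m => ¬ a * m ∣ Q).card := by
      refine Finset.card_le_card_of_injOn (b * ·) (fun m hm => ?_)
        ((mul_right_injective₀ hb).injOn)
      simp only [Finset.coe_filter, Finset.mem_filter, Set.mem_ofPred_eq, Nat.mem_divisors] at hm ⊢
      exact ⟨⟨hm.1.2, hQ⟩, by rw [← mul_assoc]; exact hm.2⟩
    have hsub' : ((Q.divisors.filter fun m => b * m ∣ Q).filter fun m => a * b * m ∣ Q).card ≤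
        (Q.divisors.filter fun m => a * b * m ∣ Q).card :=
      Finset.card_le_card (Finset.filter_subset_filter _ (Finset.filter_subset _ _))
    have := Finset.card_filter_add_card_filter_not
      (s := Q.divisors.filter fun m => b * m ∣ Q) (fun m => a * b * m ∣ Q)
    omega
  have h2 : (Q.divisors.filter fun m => ¬ a * m ∣ Q).card +
      (Q.divisors.filter fun m => a * m ∣ Q).card = Q.divisors.card := by
    rw [add_comm]; exact Finset.card_filter_add_card_filter_not _
  have key' : ((Q.divisors.filter fun m => b * m ∣ Q).card : ℝ) ≤
      (Q.divisors.filter fun m => a * b * m ∣ Q).card +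
        (Q.divisors.filter fun m => ¬ a * m ∣ Q).card := by exact_mod_cast key
  have h2' : ((Q.divisors.filter fun m => ¬ a * m ∣ Q).card : ℝ) +
      (Q.divisors.filter fun m => a * m ∣ Q).card = Q.divisors.card := by exact_mod_cast h2
  have h3 : wt Q a + wt Q b ≤ 1 + wt Q (a * b) := by
    simp only [wt]
    rw [← add_div, ← div_self h0.ne', ← add_div]
    gcongr ?_ / _
    linarith
  linarith

theorem one_sub_wt_prime_le {Q q k : ℕ} (hQ : Q ≠ 0) (hq : q.Prime) (h : q ^ k ∣ Q) :
    1 - wt Q q ≤ 1 / (k + 1) := by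
  rcases Nat.eq_zero_or_pos k with rfl | hk
  · have := wt_nonneg Q q
    norm_num; linarith
  obtain ⟨v, Q', hQ', rfl⟩ := Nat.exists_eq_pow_mul_and_not_dvd hQ q hq.ne_one
  have hkv : k ≤ v := by
    have h1 : (q ^ k).Coprime Q' := ((Nat.Prime.coprime_iff_not_dvd hq).2 hQ').pow_left k
    exact (Nat.pow_dvd_pow_iff_le_right hq.one_lt).1 (h1.dvd_of_dvd_mul_right h)
  -- With `q^(w+1)` exactly dividing `Q`, the good divisors are those of `Q / q`, so the deficit is
  -- exactly `1/(w+2)`.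
  obtain ⟨w, rfl⟩ : ∃ w, v = w + 1 := ⟨v - 1, by omega⟩
  have hcop : ∀ j, (q ^ j).Coprime Q' := fun j =>
    ((Nat.Prime.coprime_iff_not_dvd hq).2 hQ').pow_left j
  have hcard : ∀ j, (q ^ j * Q').divisors.card = (j + 1) * Q'.divisors.card := fun j => by
    rw [(hcop j).card_divisors_mul, Nat.divisors_prime_pow hq]; simp
  have hf : ((q ^ (w + 1) * Q').divisors.filter fun m => q * m ∣ q ^ (w + 1) * Q') =
      (q ^ w * Q').divisors := by
    have hQ0 : Q' ≠ 0 := right_ne_zero_of_mul hQ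
    ext m
    have h1 : q * m ∣ q ^ (w + 1) * Q' ↔ m ∣ q ^ w * Q' := by
      rw [show q ^ (w + 1) * Q' = q * (q ^ w * Q') by ring]
      exact Nat.mul_dvd_mul_iff_left hq.pos
    simp only [Finset.mem_filter, Nat.mem_divisors, h1]
    constructor
    · exact fun h => ⟨h.2, mul_ne_zero (pow_ne_zero _ hq.ne_zero) hQ0⟩
    · exact fun h => ⟨⟨h.1.trans ⟨q, by ring⟩, hQ⟩, h.1⟩
  have hQ0 : (0 : ℝ) < Q'.divisors.card := card_divisors_pos (right_ne_zero_of_mul hQ)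
  rw [wt, hf, hcard, hcard]
  have hkv' : (k : ℝ) ≤ w + 1 := by exact_mod_cast hkv
  have : (1 : ℝ) - ((w + 1) * Q'.divisors.card : ℕ) / ((w + 1 + 1) * Q'.divisors.card : ℕ)
      = 1 / (w + 1 + 1) := by
    push_cast; field_simp; ring
  rw [this]
  gcongr

/-- Subadditivity of the deficit along the prime factorization of `n`. The constant does not depend
on `Q`, so `Q` may vary with `k`. -/
theorem exists_one_sub_wt_le {n : ℕ} (hn : n ≠ 0) :
    ∃ c : ℕ, ∀ Q k : ℕ, Q ≠ 0 → (∀ q : ℕ, q.Prime → q ∣ n → q ^ k ∣ Q) →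
      1 - wt Q n ≤ c / (k + 1) := by
  induction n using Nat.recOnMul with
  | zero => exact absurd rfl hn
  | one => exact ⟨0, fun Q k hQ _ => by rw [wt_one hQ]; simp⟩
  | prime q hq => exact ⟨1, fun Q k hQ h => by simpa using one_sub_wt_prime_le hQ hq (h q hq dvd_rfl)⟩
  | mul a b ha hb =>
    have ha0 := left_ne_zero_of_mul hn
    have hb0 := right_ne_zero_of_mul hn
    obtain ⟨c, hc⟩ := ha ha0
    obtain ⟨d, hd⟩ := hb hb0
    refine ⟨c + d, fun Q k hQ h => (one_sub_wt_mul_le hQ a hb0).trans ?_⟩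
    push_cast
    rw [add_div]
    exact add_le_add (hc Q k hQ fun q hq hqa => h q hq (hqa.mul_right _))
      (hd Q k hQ fun q hq hqb => h q hq (hqb.mul_left _))

theorem tendsto_wt_of_pow_dvd {n : ℕ} (hn : n ≠ 0) {Q : ℕ → ℕ} (hQ : ∀ k, Q k ≠ 0)
    (h : ∀ᶠ k in atTop, ∀ q : ℕ, q.Prime → q ∣ n → q ^ k ∣ Q k) :
    Tendsto (fun k => wt (Q k) n) atTop (𝓝 1) := by
  obtain ⟨c, hc⟩ := exists_one_sub_wt_le hn
  have h1 : Tendsto (fun k : ℕ => 1 - (c : ℝ) * (1 / ((k : ℝ) + 1))) atTop (𝓝 (1 - c * 0)) :=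
    (tendsto_one_div_add_atTop_nhds_zero_nat.const_mul _).const_sub _
  rw [mul_zero, sub_zero] at h1
  refine tendsto_of_tendsto_of_tendsto_of_le_of_le' h1 tendsto_const_nhds ?_
    (Eventually.of_forall fun k => wt_le_one _ _)
  filter_upwards [h] with k hk
  have := hc (Q k) k (hQ k) hk
  rw [mul_one_div]; linarith

/-- Once `k ≥ n`, every prime factor of `n` divides `k!`. With `N!` in place of `k!` this works for
`N`-smooth `n` only, and all other weights vanish. -/
theorem tendsto_wt_factorial_pow {n : ℕ} (hn : n ≠ 0) :
    Tendsto (fun k => wt (k.factorial ^ k) n) atTop (𝓝 1) := by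
  refine tendsto_wt_of_pow_dvd hn (fun k => pow_ne_zero _ k.factorial_ne_zero) ?_
  filter_upwards [eventually_ge_atTop n] with k hk q hq hqn
  exact pow_dvd_pow_of_dvd (hq.dvd_factorial.2 ((Nat.le_of_dvd (Nat.pos_of_ne_zero hn) hqn).trans hk)) k

theorem tendsto_wt_smooth {N n : ℕ} (hn : n ∈ Nat.smoothNumbers (N + 1)) :
    Tendsto (fun k => wt (N.factorial ^ k) n) atTop (𝓝 1) := by
  refine tendsto_wt_of_pow_dvd (Nat.ne_zero_of_mem_smoothNumbers hn)
    (fun k => pow_ne_zero _ N.factorial_ne_zero) (Eventually.of_forall fun k q hq hqn => ?_)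
  exact pow_dvd_pow_of_dvd (hq.dvd_factorial.2
    (Nat.lt_succ_iff.1 (Nat.mem_smoothNumbers'.1 hn q hq hqn))) k

theorem wt_eq_zero_of_not_smooth {N n : ℕ} (hn : n ∉ Nat.smoothNumbers (N + 1)) (k : ℕ) :
    wt (N.factorial ^ k) n = 0 := by
  refine wt_eq_zero_of_not_dvd fun h => hn (Nat.mem_smoothNumbers'.2 fun q hq hqn => ?_)
  exact Nat.lt_succ_iff.2 (hq.dvd_factorial.1 (hq.dvd_of_dvd_pow (hqn.trans h)))

/-- The left side is the coefficient at `log n` found by squaring out the kernel; summing over `m`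
first leaves the count that defines the weight. -/
theorem sum_divisors_eq_wt {Q : ℕ} (hQ : Q ≠ 0) (n : ℕ) :
    ((Q.divisors.card : ℂ)⁻¹ * ∑ m ∈ Q.divisors, ∑ m' ∈ Q.divisors,
      if n * m' = m then 1 else 0) = wt Q n := by
  have h1 : ∀ m' ∈ Q.divisors, ∑ m ∈ Q.divisors, (if n * m' = m then (1 : ℂ) else 0) =
      if n * m' ∣ Q then 1 else 0 := fun m' _ => by
    rw [Finset.sum_ite_eq]; simp [hQ]
  rw [Finset.sum_comm, Finset.sum_congr rfl h1, Finset.sum_boole, wt]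
  push_cast
  rw [div_eq_inv_mul]

/-! ### The associated kernels -/

/-- A nonnegative trigonometric polynomial of mean `1` whose Fourier coefficients at `log n` are
the weights `wt Q n`. -/
def ker (Q : ℕ) (t : ℝ) : ℝ :=
  (Q.divisors.card : ℝ)⁻¹ * ‖∑ m ∈ Q.divisors, expo (Real.log m) t‖ ^ 2

theorem ker_nonneg (Q : ℕ) (t : ℝ) : 0 ≤ ker Q t := by unfold ker; positivity

theorem continuous_ker (Q : ℕ) : Continuous (ker Q) :=
  ((continuous_finsetSum _ fun _ _ => continuous_expo _).norm.pow 2).const_mul _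

theorem star_expo (l t : ℝ) : star (expo l t) = expo (-l) t := by
  simp only [expo, ← starRingEnd_apply, ← Complex.exp_conj, map_mul, Complex.conj_ofReal,
    Complex.conj_I]
  congr 1; push_cast; ring

theorem ker_eq (Q : ℕ) (t : ℝ) : (ker Q t : ℂ) = (Q.divisors.card : ℂ)⁻¹ *
    ∑ m ∈ Q.divisors, ∑ m' ∈ Q.divisors, expo (Real.log m - Real.log m') t := by
  have h : ∀ z : ℂ, ((‖z‖ ^ 2 : ℝ) : ℂ) = z * star z := fun z => by
    rw [← starRingEnd_apply, Complex.mul_conj, Complex.normSq_eq_norm_sq]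
  simp only [ker, Complex.ofReal_mul, h, star_sum, star_expo, Finset.sum_mul_sum]
  push_cast
  congr 1
  refine Finset.sum_congr rfl fun m _ => Finset.sum_congr rfl fun m' _ => ?_
  rw [← Pi.mul_apply, expo_mul, sub_eq_add_neg]

/-- If `f` has means against all characters, then the means of `f` against the kernel are obtained
termwise. -/
theorem tendsto_mean_mul_ker {f : ℝ → ℂ} (hf : Continuous f) {V : ℝ → ℂ}
    (h : ∀ l, Tendsto (mean fun t => f t * expo l t) atTop (𝓝 (V l))) (Q : ℕ) :
    Tendsto (mean fun t => f t * (ker Q t : ℂ)) atTop (𝓝 ((Q.divisors.card : ℂ)⁻¹ *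
      ∑ m ∈ Q.divisors, ∑ m' ∈ Q.divisors, V (Real.log m - Real.log m'))) := by
  have h1 : ∀ T, mean (fun t => f t * (ker Q t : ℂ)) T = (Q.divisors.card : ℂ)⁻¹ *
      ∑ m ∈ Q.divisors, ∑ m' ∈ Q.divisors,
        mean (fun t => f t * expo (Real.log m - Real.log m') t) T := by
    intro T
    have hc : ∀ l, Continuous fun t => f t * expo l t := fun l => hf.mul (continuous_expo l)
    simp only [ker_eq]
    have h2 : ∀ m ∈ Q.divisors, ∑ m' ∈ Q.divisors,
        mean (fun t => f t * expo (Real.log (m : ℕ) - Real.log (m' : ℕ)) t) T =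
        mean (fun t => ∑ m' ∈ Q.divisors, f t * expo (Real.log (m : ℕ) - Real.log (m' : ℕ)) t) T :=
      fun m _ => (mean_sum Q.divisors (fun m' _ => hc _) T).symm
    rw [Finset.sum_congr rfl h2, ← mean_sum Q.divisors (f := fun m t => ∑ m' ∈ Q.divisors,
        f t * expo (Real.log (m : ℕ) - Real.log (m' : ℕ)) t)
        (fun m _ => continuous_finsetSum _ fun m' _ => hc _) T, ← mean_const_mul]
    congr 1
    funext t
    simp only [← Finset.mul_sum]
    ring
  rw [show (mean fun t => f t * (ker Q t : ℂ)) = _ from funext h1]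
  exact (tendsto_finsetSum _ fun m _ => tendsto_finsetSum _ fun m' _ => h _).const_mul _

theorem log_natCast_eq_iff {n m m' : ℕ} (hn : n ≠ 0) (hm : m ≠ 0) (hm' : m' ≠ 0) :
    Real.log n = Real.log m - Real.log m' ↔ n * m' = m := by
  have h1 : (0 : ℝ) < n := by positivity
  have h2 : (0 : ℝ) < m := by positivity
  have h3 : (0 : ℝ) < m' := by positivity
  rw [eq_sub_iff_add_eq, ← Real.log_mul h1.ne' h3.ne']
  constructor
  · intro h
    exact_mod_cast Real.log_injOn_pos (Set.mem_Ioi.2 (by positivity)) (Set.mem_Ioi.2 h2) h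
  · rintro rfl; push_cast; rfl

theorem tendsto_mean_expo_mul_ker {Q : ℕ} (hQ : Q ≠ 0) {n : ℕ} (hn : n ≠ 0) :
    Tendsto (mean fun t => expo (Real.log n) t * (ker Q t : ℂ)) atTop (𝓝 (wt Q n : ℂ)) := by
  have h := tendsto_mean_mul_ker (continuous_expo (Real.log n))
    (V := fun l => if Real.log n + l = 0 then 1 else 0) (fun l => by
      simpa only [← Pi.mul_apply, ← expo_mul] using tendsto_mean_expo (Real.log n + l)) Q
  convert h using 2
  -- The surviving frequencies satisfy `n * m = m'`, so the roles of the two divisors are exchanged.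
  rw [← sum_divisors_eq_wt hQ, Finset.sum_comm]
  congr 1
  refine Finset.sum_congr rfl fun m hm => Finset.sum_congr rfl fun m' hm' => ?_
  have := log_natCast_eq_iff hn (Nat.pos_of_mem_divisors hm').ne' (Nat.pos_of_mem_divisors hm).ne'
  simp only [← this]
  congr 1
  rw [eq_iff_iff]
  constructor <;> intro h <;> linarith

theorem tendsto_mean_ker {Q : ℕ} (hQ : Q ≠ 0) : Tendsto (mean (ker Q)) atTop (𝓝 1) := by
  have h := tendsto_mean_expo_mul_ker hQ one_ne_zero
  simp only [Nat.cast_one, Real.log_one, expo_zero, Pi.one_apply, one_mul, wt_one hQ] at h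
  have h2 := (Complex.continuous_re.tendsto _).comp h
  refine h2.congr fun T => ?_
  exact (mean_re (fun t => (ker Q t : ℂ))
    (Complex.continuous_ofReal.comp (continuous_ker Q)) T).symm

/-! ### Mean values of bounded holomorphic functions with a Dirichlet series -/

/-- Means over vertical lines do not depend on the line. -/
theorem tendsto_mean_sub_mean {G : ℂ → ℂ} (hG : DifferentiableOn ℂ G {z | 0 ≤ z.re}) {x B : ℝ}
    (hx : 0 ≤ x) (hB : ∀ z : ℂ, 0 ≤ z.re → z.re ≤ x → ‖G z‖ ≤ B) :
    Tendsto (fun T => mean (fun t => G (t * Complex.I)) T - mean (fun t => G (x + t * Complex.I)) T)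
      atTop (𝓝 0) := by
  rw [tendsto_zero_iff_norm_tendsto_zero]
  refine squeeze_zero' (Eventually.of_forall fun _ => norm_nonneg _) ?_
    (tendsto_const_div_atTop (B * |x - 0| + B * |x - 0|))
  filter_upwards [eventually_gt_atTop 0] with T hT
  -- Cauchy's theorem on the rectangle `[0, x] × [-T, T]`: the horizontal sides contribute at most
  -- `B * x` each, which disappears after division by `2T`.
  have h := Complex.integral_boundary_rect_eq_zero_of_differentiableOn G (-T * Complex.I)
    (x + T * Complex.I) (hG.mono fun z hz => by
      have h1 := hz.1
      simp only [Set.mem_preimage] at h1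
      have h2 := (Set.uIcc_of_le (a := (0 : ℝ)) (b := x) hx)
      simp [h2] at h1
      exact h1.1)
  simp at h
  have hb : ∀ y : ℝ, ‖∫ u in (0 : ℝ)..x, G (u + y * Complex.I)‖ ≤ B * |x - 0| := fun y =>
    intervalIntegral.norm_integral_le_of_norm_le_const fun u hu => by
      rw [Set.uIoc_of_le hx] at hu
      exact hB _ (by simpa using hu.1.le) (by simpa using hu.2)
  have h3 := hb (-T)
  have h4 := hb T
  simp only [Complex.ofReal_neg, neg_mul] at h3
  simp only [mean, ← smul_sub, norm_smul]
  rw [Real.norm_of_nonneg (by positivity : (0 : ℝ) ≤ (2 * T)⁻¹)]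
  refine mul_le_mul_of_nonneg_left ?_ (by positivity)
  rw [← one_mul ‖_ - _‖, ← Complex.norm_I, ← norm_mul, mul_sub]
  refine le_trans (le_of_eq ?_) ((norm_sub_le _ _).trans (add_le_add h3 h4))
  congr 1
  linear_combination -h

theorem term_add_mul_I (a : ℕ → ℂ) (s : ℂ) (t : ℝ) (n : ℕ) :
    LSeries.term a (s + t * Complex.I) n = LSeries.term a s n * expo (-Real.log n) t := by
  rcases eq_or_ne n 0 with rfl | hn
  · simp
  have hn' : (n : ℂ) ≠ 0 := by exact_mod_cast hn
  rw [LSeries.term_of_ne_zero hn, LSeries.term_of_ne_zero hn, Complex.cpow_add _ _ hn', div_mul_eq_div_div,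
    div_eq_mul_inv (_ / _), ← Complex.cpow_neg, Complex.cpow_def_of_ne_zero hn' (-(t * Complex.I)), expo,
    ← Complex.natCast_log]
  congr 2; push_cast; ring

theorem term_add_real (a : ℕ → ℂ) (s : ℂ) (x : ℝ) (n : ℕ) :
    LSeries.term a (s + x) n = LSeries.term a s n * Real.exp (-(Real.log n * x)) := by
  rcases eq_or_ne n 0 with rfl | hn
  · simp
  have hn' : (n : ℂ) ≠ 0 := by exact_mod_cast hn
  rw [LSeries.term_of_ne_zero hn, LSeries.term_of_ne_zero hn, Complex.cpow_add _ _ hn', div_mul_eq_div_div,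
    div_eq_mul_inv (_ / _), ← Complex.cpow_neg, Complex.cpow_def_of_ne_zero hn' (-(x : ℂ)),
    ← Complex.natCast_log]
  congr 1; push_cast; congr 1; ring

theorem norm_mean_expo_le (l : ℝ) {T : ℝ} (hT : 0 < T) : ‖mean (expo l) T‖ ≤ 1 := by
  refine (norm_mean_le_integral _ hT).trans ?_
  simp only [norm_expo]
  rw [mean_const _ hT]

/-- Dominated convergence with majorant `‖c n‖`, used twice: to integrate termwise and to let `T →
∞` termwise. -/
theorem tendsto_mean_tsum {c : ℕ → ℂ} (hc : Summable fun n => ‖c n‖) (l : ℝ) :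
    Tendsto (mean fun t => (∑' n, c n * expo (-Real.log n) t) * expo l t) atTop
      (𝓝 (∑' n : ℕ, if Real.log n = l then c n else 0)) := by
  have h1 : ∀ T, mean (fun t => (∑' n, c n * expo (-Real.log n) t) * expo l t) T =
      ∑' n : ℕ, c n * mean (expo (l - Real.log n)) T := by
    intro T
    have h2 : HasSum (fun n : ℕ => ∫ t in (-T)..T, c n * expo (l - Real.log n) t)
        (∫ t in (-T)..T, (∑' n, c n * expo (-Real.log n) t) * expo l t) := by
      refine intervalIntegral.hasSum_integral_of_dominated_convergence (fun n _ => ‖c n‖)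
        (fun n => ((continuous_expo _).const_mul _).aestronglyMeasurable)
        (fun n => Eventually.of_forall fun t _ => by simp [norm_expo])
        (Eventually.of_forall fun t _ => hc) (by simp) (Eventually.of_forall fun t _ => ?_)
      have h3 : Summable fun n : ℕ => c n * expo (-Real.log n) t :=
        Summable.of_norm (by simpa [norm_expo] using hc)
      have h4 : ∀ n : ℕ, c n * expo (l - Real.log n) t =
          c n * expo (-Real.log n) t * expo l t := fun n => by
        rw [mul_assoc, ← Pi.mul_apply, expo_mul, neg_add_eq_sub]
      simp only [h4]
      exact h3.hasSum.mul_right (expo l t)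
    rw [mean, ← h2.tsum_eq, Complex.real_smul, ← tsum_mul_left]
    refine tsum_congr fun n => ?_
    rw [← mean_const_mul, mean, Complex.real_smul]
  rw [show (mean fun t => (∑' n, c n * expo (-Real.log n) t) * expo l t) = _ from funext h1]
  refine tendsto_tsum_of_dominated_convergence hc (fun n => ?_) ?_
  · have := (tendsto_mean_expo (l - Real.log n)).const_mul (c n)
    convert this using 2
    rw [mul_ite, mul_one, mul_zero]
    congr 1
    rw [sub_eq_zero]
    exact propext eq_comm
  · filter_upwards [eventually_gt_atTop 0] with T hT n
    rw [norm_mul]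
    exact mul_le_of_le_one_right (norm_nonneg _) (norm_mean_expo_le _ hT)

variable {a : ArithmeticFunction ℂ} {D : ℂ → ℂ}

theorem isOpen_halfPlane (σ : ℝ) : IsOpen (halfPlane σ) :=
  isOpen_lt continuous_const Complex.continuous_re

theorem continuous_vertical (hD : DifferentiableOn ℂ D (halfPlane 0)) {s : ℂ} (hs : 0 < s.re) :
    Continuous fun t : ℝ => D (s + t * Complex.I) := by
  refine hD.continuousOn.comp_continuous (by fun_prop) fun t => ?_
  simpa [halfPlane] using hs

/-- The line is moved right into the region of absolute convergence, using `G z = D (s + z) * exp (l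
* z)`. The factor `e^{lx}` cancels `n^{-x}` exactly when `log n = l`. No convergence at `s` is
needed, since at most one term of the limiting sum is nonzero (the index `0`, where `log` is also
`0`, has zero term). -/
theorem tendsto_mean_mul_expo (hD : MemHardyInfty a D) {s : ℂ} (hs : 0 < s.re) (l : ℝ) :
    Tendsto (mean fun t => D (s + t * Complex.I) * expo l t) atTop
      (𝓝 (∑' n : ℕ, if Real.log n = l then LSeries.term a s n else 0)) := by
  obtain ⟨C, hC⟩ := hD.bounded
  obtain ⟨σ, hσ, hser⟩ := hD.series
  obtain ⟨x, hx0, hx⟩ : ∃ x : ℝ, 0 ≤ x ∧ σ < (s + x).re := by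
    refine ⟨σ, hσ, ?_⟩
    simpa using hs
  have hmem : ∀ z : ℂ, 0 ≤ z.re → s + z ∈ halfPlane 0 := fun z hz => by
    simp only [halfPlane, Set.mem_ofPred_eq, Complex.add_re]; linarith
  have h1 := tendsto_mean_sub_mean (G := fun z => D (s + z) * Complex.exp (l * z)) (x := x)
    (B := C * Real.exp (|l| * x))
    ((hD.holo.comp (by fun_prop) fun z hz => hmem z hz).mul (by fun_prop)) hx0 (fun z hz hzx => by
      rw [norm_mul, Complex.norm_exp]
      refine mul_le_mul (hC _ (hmem z hz)) (Real.exp_le_exp.2 ?_) (by positivity)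
        ((norm_nonneg _).trans (hC _ (hmem z hz)))
      simp only [Complex.re_ofReal_mul]
      exact mul_le_mul (le_abs_self l) hzx hz (abs_nonneg l))
  have h2 := (tendsto_mean_tsum (c := LSeries.term a (s + x)) (hser _ hx).summable.norm l).const_mul
    (Complex.exp (l * x))
  have h3 : (mean fun t : ℝ => D (s + (x + t * Complex.I)) * Complex.exp (l * (x + t * Complex.I)))
      = fun T => Complex.exp (l * x) * mean (fun t : ℝ => (∑' n : ℕ, LSeries.term a (s + x) n *
        expo (-Real.log n) t) * expo l t) T := by
    funext T
    rw [← mean_const_mul]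
    congr 1
    funext t
    have h4 : s + x + t * Complex.I ∈ halfPlane σ := by
      simpa [halfPlane] using hx
    rw [← add_assoc, ← (hser _ h4).LSeries_eq, LSeries, mul_add, Complex.exp_add]
    simp only [term_add_mul_I, expo]
    rw [show (l : ℂ) * (t * Complex.I) = l * Complex.I * t by ring]
    ring
  have h5 : Complex.exp (l * x) *
      (∑' n : ℕ, if Real.log n = l then LSeries.term a (s + x) n else 0) =
      ∑' n : ℕ, if Real.log n = l then LSeries.term a s n else 0 := by
    rw [← tsum_mul_left]
    refine tsum_congr fun n => ?_
    split_ifs with h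
    · rw [term_add_real, h, mul_comm, mul_assoc]
      push_cast
      rw [← Complex.exp_add]; simp
    · simp
  have h6 := h1.add (h3 ▸ h2)
  rw [h5, zero_add] at h6
  refine h6.congr fun T => ?_
  rw [sub_add_cancel]
  congr 1
  funext t
  rw [expo, show (l : ℂ) * (t * Complex.I) = l * Complex.I * t by ring]

/-- The Fejér-type sums of a series in `ℋ^∞` are bounded on `ℂ_0` by the bound of its sum. -/
theorem norm_sum_wt_le (hD : MemHardyInfty a D) {C : ℝ} (hC : ∀ s ∈ halfPlane 0, ‖D s‖ ≤ C)
    {Q : ℕ} (hQ : Q ≠ 0) {s : ℂ} (hs : 0 < s.re) :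
    ‖∑ n ∈ Q.divisors, (wt Q n : ℂ) * LSeries.term a s n‖ ≤ C := by
  have hcont := continuous_vertical hD.holo hs
  have h := tendsto_mean_mul_ker hcont (tendsto_mean_mul_expo hD hs) Q
  have h1 : (Q.divisors.card : ℂ)⁻¹ * ∑ m ∈ Q.divisors, ∑ m' ∈ Q.divisors,
      (∑' n : ℕ, if Real.log n = Real.log m - Real.log m' then LSeries.term a s n else 0) =
      ∑ n ∈ Q.divisors, (wt Q n : ℂ) * LSeries.term a s n := by
    have h2 : ∀ m ∈ Q.divisors, ∀ m' ∈ Q.divisors,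
        (∑' n : ℕ, if Real.log n = Real.log m - Real.log m' then LSeries.term a s n else 0) =
        ∑ n ∈ Q.divisors, (if n * m' = m then 1 else 0) * LSeries.term a s n := by
      intro m hm m' hm'
      have h3 : ∀ n : ℕ, (if Real.log n = Real.log m - Real.log m' then LSeries.term a s n else 0) =
          (if n * m' = m then 1 else 0) * LSeries.term a s n := by
        intro n
        rcases eq_or_ne n 0 with rfl | hn
        · simp
        simp only [log_natCast_eq_iff hn (Nat.pos_of_mem_divisors hm).ne'
          (Nat.pos_of_mem_divisors hm').ne', ite_mul, one_mul, zero_mul]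
      rw [tsum_congr h3]
      refine tsum_eq_sum fun n hn => ?_
      rw [if_neg, zero_mul]
      intro h
      exact hn (Nat.mem_divisors.2
        ⟨(Dvd.intro _ h).trans (Nat.dvd_of_mem_divisors hm), hQ⟩)
    rw [Finset.sum_congr rfl fun m hm => Finset.sum_congr rfl (h2 m hm),
      Finset.sum_congr rfl fun m _ => Finset.sum_comm, Finset.sum_comm, Finset.mul_sum]
    refine Finset.sum_congr rfl fun n _ => ?_
    rw [← sum_divisors_eq_wt hQ]
    simp only [← Finset.sum_mul]
    ring
  rw [h1] at h
  have h4 : Tendsto (fun T => C * mean (ker Q) T) atTop (𝓝 (C * 1)) :=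
    (tendsto_mean_ker hQ).const_mul C
  rw [mul_one] at h4
  refine le_of_tendsto_of_tendsto h.norm h4 ?_
  filter_upwards [eventually_gt_atTop 0] with T hT
  refine (norm_mean_le_integral _ hT).trans ?_
  have h5 : C * mean (ker Q) T = mean (fun t => C * ker Q t) T := by
    simp only [mean, intervalIntegral.integral_const_mul, smul_eq_mul]; ring
  rw [h5]
  refine mean_mono ((hcont.mul (Complex.continuous_ofReal.comp (continuous_ker Q))).norm)
    ((continuous_ker Q).const_mul C) (fun t => ?_) hT
  change ‖D (s + t * Complex.I) * (ker Q t : ℂ)‖ ≤ _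
  rw [norm_mul, Complex.norm_real, Real.norm_of_nonneg (ker_nonneg Q t)]
  exact mul_le_mul_of_nonneg_right (hC _ (by simpa [halfPlane] using hs)) (ker_nonneg Q t)

/-! ### Weighted Dirichlet polynomials -/

theorem finite_support_wt (a : ℕ → ℂ) {Q : ℕ} (hQ : Q ≠ 0) :
    (Function.support fun n : ℕ+ => (wt Q n : ℂ) * a n).Finite := by
  refine (Q.divisors.finite_toSet.preimage PNat.coe_injective.injOn).subset fun n hn => ?_
  simp only [Set.mem_preimage, Finset.mem_coe, Nat.mem_divisors]
  refine ⟨?_, hQ⟩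
  by_contra h
  exact hn (by simp [wt_eq_zero_of_not_dvd h])

/-- The Dirichlet polynomial `∑ wt Q n * aₙ n⁻ˢ`. -/
def fejer (a : ℕ → ℂ) (Q : ℕ) (hQ : Q ≠ 0) : ℕ+ →₀ ℂ :=
  Finsupp.ofSupportFinite _ (finite_support_wt a hQ)

theorem fejer_apply (a : ℕ → ℂ) {Q : ℕ} (hQ : Q ≠ 0) (n : ℕ+) :
    fejer a Q hQ n = (wt Q n : ℂ) * a n := rfl

theorem evalIm_fejer (a : ℕ → ℂ) {Q : ℕ} (hQ : Q ≠ 0) (t : ℝ) :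
    evalIm (fejer a Q hQ) t = ∑ n ∈ Q.divisors, (wt Q n : ℂ) * LSeries.term a (-t * Complex.I) n := by
  rw [evalIm_eq, Finset.sum_apply]
  have hterm : ∀ n : ℕ, n ≠ 0 →
      LSeries.term a (-t * Complex.I) n = a n * expo (Real.log n) t := fun n hn => by
    have := term_add_mul_I a 0 (-t) n
    push_cast at this
    rw [zero_add] at this
    rw [this, LSeries.term_of_ne_zero hn, Complex.cpow_zero, div_one, expo, expo]
    congr 2; push_cast; ring
  have h1 : ∀ n ∈ (fejer a Q hQ).support, (fejer a Q hQ n • expo (Real.log (n : ℕ))) t =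
      (wt Q (n : ℕ) : ℂ) * LSeries.term a (-t * Complex.I) n := fun n _ => by
    rw [Pi.smul_apply, smul_eq_mul, fejer_apply, hterm n n.ne_zero, mul_assoc]
  rw [Finset.sum_congr rfl h1]
  have h2 := Finset.sum_map (fejer a Q hQ).support ⟨PNat.val, PNat.coe_injective⟩
    fun n : ℕ => (wt Q n : ℂ) * LSeries.term a (-t * Complex.I) n
  refine h2.symm.trans (Finset.sum_subset (fun n hn => ?_) fun n hn hn' => ?_)
  · obtain ⟨m, hm, rfl⟩ := Finset.mem_map.1 hn
    refine Nat.mem_divisors.2 ⟨?_, hQ⟩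
    by_contra h
    refine Finsupp.mem_support_iff.1 hm ?_
    have h3 : wt Q (m : ℕ) = 0 := wt_eq_zero_of_not_dvd h
    rw [fejer_apply, h3]; simp
  · by_contra h
    have hn0 : 0 < n := Nat.pos_of_mem_divisors hn
    refine hn' (Finset.mem_map.2 ⟨⟨n, hn0⟩, Finsupp.mem_support_iff.2 ?_, rfl⟩)
    rw [hterm n hn0.ne', ← mul_assoc] at h
    exact left_ne_zero_of_mul h

/-- A finite sum is continuous up to the imaginary axis, so the bound on `ℂ_0` passes to the
boundary point `-it`. -/
theorem norm_evalIm_fejer_le (hD : MemHardyInfty a D) {C : ℝ} (hC : ∀ s ∈ halfPlane 0, ‖D s‖ ≤ C)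
    {Q : ℕ} (hQ : Q ≠ 0) (t : ℝ) : ‖evalIm (fejer a Q hQ) t‖ ≤ C := by
  rw [evalIm_fejer]
  have h : Continuous fun x : ℝ =>
      ‖∑ n ∈ Q.divisors, (wt Q n : ℂ) * LSeries.term a (-t * Complex.I + x) n‖ := by
    simp only [term_add_real]
    fun_prop
  have h1 := (h.tendsto 0).mono_left (nhdsWithin_le_nhds (s := Set.Ioi 0))
  simp only [Complex.ofReal_zero, add_zero] at h1
  refine le_of_tendsto h1 ?_
  filter_upwards [self_mem_nhdsWithin] with x hx
  exact norm_sum_wt_le hD hC hQ (by simpa using hx)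

/-- Parseval for the Fejér polynomials, which are bounded by `C` on the imaginary axis; on a fixed
finite set the weights then tend to `1`. -/
theorem sum_sq_le (hD : MemHardyInfty a D) {C : ℝ} (hC : ∀ s ∈ halfPlane 0, ‖D s‖ ≤ C)
    (S : Finset ℕ+) : ∑ n ∈ S, ‖a n‖ ^ 2 ≤ C ^ 2 := by
  have hC0 : 0 ≤ C := (norm_nonneg _).trans (hC 1 (by simp [halfPlane]))
  have hQ : ∀ k : ℕ, k.factorial ^ k ≠ 0 := fun k => pow_ne_zero _ k.factorial_ne_zero
  have h1 : ∀ k, ∑ n ∈ S, ‖fejer a _ (hQ k) n‖ ^ 2 ≤ C ^ 2 := by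
    intro k
    set P := fejer a _ (hQ k)
    have h2 : ∑ n ∈ P.support, ‖P n‖ ^ 2 ≤ C ^ 2 := by
      refine le_of_tendsto (tendsto_mean_sq P) ?_
      filter_upwards [eventually_gt_atTop 0] with T hT
      refine (mean_mono ((continuous_evalIm P).norm.pow 2) continuous_const (fun t => ?_) hT).trans
        (mean_const (C ^ 2) hT).le
      exact pow_le_pow_left₀ (norm_nonneg _) (norm_evalIm_fejer_le hD hC (hQ k) t) 2
    refine le_trans ?_ h2
    rw [← Finset.sum_filter_of_ne (p := fun n => n ∈ P.support) fun n _ hn => ?_]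
    · exact Finset.sum_le_sum_of_subset_of_nonneg (fun n hn => (Finset.mem_filter.1 hn).2)
        fun _ _ _ => by positivity
    · refine Finsupp.mem_support_iff.2 fun h => hn (by rw [h]; simp)
  have h3 : Tendsto (fun k => ∑ n ∈ S, ‖fejer a _ (hQ k) n‖ ^ 2) atTop
      (𝓝 (∑ n ∈ S, ‖a n‖ ^ 2)) := by
    refine tendsto_finsetSum _ fun n _ => ?_
    have h4 : Tendsto (fun k => ((wt (k.factorial ^ k) n : ℝ) : ℂ) * a n) atTop (𝓝 ((1 : ℝ) * a n)) :=
      ((Complex.continuous_ofReal.tendsto _).comp (tendsto_wt_factorial_pow n.ne_zero)).mul_const _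
    rw [Complex.ofReal_one, one_mul] at h4
    exact h4.norm.pow 2
  exact le_of_tendsto' h3 h1

theorem norm_apply_le (hD : MemHardyInfty a D) {C : ℝ} (hC : ∀ s ∈ halfPlane 0, ‖D s‖ ≤ C)
    (n : ℕ) : ‖a n‖ ≤ C := by
  have hC0 : 0 ≤ C := (norm_nonneg _).trans (hC 1 (by simp [halfPlane]))
  rcases Nat.eq_zero_or_pos n with rfl | hn
  · simpa using hC0
  have h := (Finset.sum_singleton (fun m : ℕ+ => ‖a m‖ ^ 2) ⟨n, hn⟩).symm.trans_le
    (sum_sq_le hD hC {⟨n, hn⟩})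
  exact (sq_le_sq₀ (norm_nonneg _) hC0).1 h

theorem summable_sq (hD : MemHardyInfty a D) : Summable fun n : ℕ+ => ‖a n‖ ^ 2 := by
  obtain ⟨C, hC⟩ := hD.bounded
  exact summable_of_sum_le (fun _ => by positivity) (sum_sq_le hD hC)

/-! ### Coefficients of elements of `ℋ^p` -/

section Hardy

variable {p : ℝ} [hp : Fact (1 ≤ p)]

/-- The embedding of the Dirichlet polynomials into `ℋ^p`. -/
def toHardy (p : ℝ) [Fact (1 ≤ p)] : (ℕ+ →₀ ℂ) →ₗ[ℂ] Hardy p :=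
  (UniformSpace.Completion.toComplL (𝕜 := ℂ) (E := DirichletPoly p)).toLinearMap ∘ₗ
    (toFinsupp p).symm.toLinearMap

theorem norm_toHardy (P : ℕ+ →₀ ℂ) : ‖toHardy p P‖ = polyNorm p P :=
  UniformSpace.Completion.norm_coe ((toFinsupp p).symm P)

theorem hardy_induction {q : Hardy p → Prop} (f : Hardy p) (hq : IsClosed {f | q f})
    (h : ∀ P, q (toHardy p P)) : q f :=
  UniformSpace.Completion.induction_on f hq fun P => h (toFinsupp p P)

theorem denseRange_toHardy : DenseRange (toHardy p) := fun f =>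
  hardy_induction f isClosed_closure fun P => subset_closure (Set.mem_range_self P)

/-- The `n`-th coefficient functional on `ℋ^p`. -/
def coeffL (p : ℝ) [Fact (1 ≤ p)] (n : ℕ+) : Hardy p →L[ℂ] ℂ := (polyCoeff p n).fromCompletion

theorem coeffL_toHardy (n : ℕ+) (P : ℕ+ →₀ ℂ) : coeffL p n (toHardy p P) = P n :=
  (polyCoeff p n).fromCompletion_apply_coe ((toFinsupp p).symm P)

theorem coeffs_apply (f : Hardy p) (n : ℕ+) : coeffs f n = coeffL p n f := by
  change (if h : 0 < (n : ℕ) then (polyCoeff p ⟨n, h⟩).fromCompletion f else 0) = _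
  rw [dif_pos n.pos]; rfl

theorem coeffs_ext {b c : ArithmeticFunction ℂ} (h : ∀ n : ℕ+, b n = c n) : b = c := by
  ext n
  rcases Nat.eq_zero_or_pos n with rfl | hn
  · simp
  · exact h ⟨n, hn⟩

theorem norm_coeffL_le (f : Hardy p) (n : ℕ+) : ‖coeffL p n f‖ ≤ ‖f‖ := by
  refine hardy_induction f (isClosed_le (coeffL p n).continuous.norm continuous_norm) fun P => ?_
  rw [coeffL_toHardy, norm_toHardy]
  exact norm_coeff_le hp.out P n

theorem norm_coeffs_le (f : Hardy p) (n : ℕ) : ‖coeffs f n‖ ≤ ‖f‖ := by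
  rcases Nat.eq_zero_or_pos n with rfl | hn
  · simp
  · have := coeffs_apply f ⟨n, hn⟩
    rw [PNat.mk_coe] at this
    rw [this]
    exact norm_coeffL_le f _

theorem coeffs_add (f g : Hardy p) : coeffs (f + g) = coeffs f + coeffs g :=
  coeffs_ext fun n => by simp [coeffs_apply]

theorem coeffs_sub (f g : Hardy p) : coeffs (f - g) = coeffs f - coeffs g :=
  coeffs_ext fun n => by simp [coeffs_apply, sub_eq_add_neg]

theorem coeffs_smul (c : ℂ) (f : Hardy p) (n : ℕ) : coeffs (c • f) n = c * coeffs f n := by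
  rcases Nat.eq_zero_or_pos n with rfl | hn
  · simp
  · have h1 := coeffs_apply (c • f) ⟨n, hn⟩
    have h2 := coeffs_apply f ⟨n, hn⟩
    rw [PNat.mk_coe] at h1 h2
    rw [h1, h2]; simp

theorem coeffs_toHardy (P : ℕ+ →₀ ℂ) (n : ℕ+) : coeffs (toHardy p P) n = P n := by
  rw [coeffs_apply, coeffL_toHardy]

theorem coeffs_polyMul (A P : ℕ+ →₀ ℂ) :
    coeffs (toHardy p (polyMul A P)) = coeffs (toHardy p A) * coeffs (toHardy p P) := by
  have hmul0 : coeffs (toHardy p 0) = 0 := coeffs_ext fun n => coeffs_toHardy 0 n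
  induction P using Finsupp.induction_linear with
  | zero => rw [map_zero, hmul0, mul_zero]
  | add f g hf hg => rw [map_add, map_add, map_add, coeffs_add, coeffs_add, hf, hg, mul_add]
  | single m d =>
    rw [polyMul_single]
    induction A using Finsupp.induction_linear with
    | zero => rw [Finsupp.mapDomain_zero, smul_zero, hmul0, zero_mul]
    | add f g hf hg =>
      rw [Finsupp.mapDomain_add, smul_add, map_add, map_add, coeffs_add, coeffs_add, hf, hg,
        add_mul]
    | single n c =>
      refine coeffs_ext fun k => ?_
      rw [Finsupp.mapDomain_single, Finsupp.smul_single, coeffs_toHardy, ArithmeticFunction.mul_apply]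
      have hs : ∀ (n : ℕ+) (c : ℂ) (j : ℕ), j ≠ n → coeffs (toHardy p (Finsupp.single n c)) j = 0 := by
        intro n c j hj
        rcases Nat.eq_zero_or_pos j with rfl | hj0
        · simp
        · refine (coeffs_toHardy (p := p) (Finsupp.single n c) ⟨j, hj0⟩).trans
            (Finsupp.single_eq_of_ne fun h => hj (by rw [← h]; rfl))
      by_cases h : n * m = k
      · rw [Finset.sum_eq_single ((n : ℕ), (m : ℕ))]
        · simp [coeffs_toHardy, h, mul_comm]
        · rintro ⟨i, j⟩ hij hne
          by_cases hi : i = n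
          · have hj : j ≠ m := fun hj => hne (by rw [hi, hj])
            simp [hs m d j hj]
          · simp [hs n c i hi]
        · intro h'
          exact absurd (Nat.mem_divisorsAntidiagonal.2 ⟨by rw [← h]; rfl, k.ne_zero⟩) h'
      · rw [Finsupp.single_eq_of_ne (fun h' => h h'.symm)]
        refine (Finset.sum_eq_zero ?_).symm
        rintro ⟨i, j⟩ hij
        by_cases hi : i = n
        · by_cases hj : j = m
          · refine absurd (PNat.eq ?_) h
            rw [PNat.mul_coe, ← hi, ← hj]
            exact (Nat.mem_divisorsAntidiagonal.1 hij).1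
          · simp [hs m d j hj]
        · simp [hs n c i hi]

theorem toHardy_scale (w : ℕ+ → ℂ) (P : ℕ+ →₀ ℂ) :
    toHardy p (scale w P) = ∑ n ∈ P.support, w n • toHardy p (Finsupp.single n (P n)) := by
  conv_lhs => rw [← Finsupp.sum_single P]
  simp only [Finsupp.sum, map_sum, scale_single]
  refine Finset.sum_congr rfl fun n _ => ?_
  rw [← map_smul, Finsupp.smul_single, smul_eq_mul, mul_comm]

/-! ### Fejér-type summation is a contraction, and coefficients determine elements -/

theorem mean_smul_const {E : Type*} [NormedAddCommGroup E] [NormedSpace ℂ E]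
    [CompleteSpace E] (g : ℝ → ℂ)
    (v : E) (T : ℝ) : mean (fun t => g t • v) T = mean g T • v := by
  simp only [mean]
  rw [intervalIntegral.integral_smul_const, smul_assoc]

/-- The weighted polynomial is an average, against a nonnegative kernel of mean `1`, of vertical
translates of `P`, all of the same norm. The average is formed in `Hardy p`, where completeness
makes vector-valued integrals available. -/
theorem polyNorm_scale_wt_le {Q : ℕ} (hQ : Q ≠ 0) (P : ℕ+ →₀ ℂ) :
    polyNorm p (scale (fun n => (wt Q n : ℂ)) P) ≤ polyNorm p P := by
  have hcont : ∀ n : ℕ+, Continuous fun u => expo (Real.log (n : ℕ)) u * (ker Q u : ℂ) := fun n =>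
    (continuous_expo _).mul (Complex.continuous_ofReal.comp (continuous_ker Q))
  have h1 : Tendsto (mean fun u => ∑ n ∈ P.support, (expo (Real.log (n : ℕ)) u * (ker Q u : ℂ)) •
      toHardy p (Finsupp.single n (P n))) atTop
      (𝓝 (toHardy p (scale (fun n => (wt Q n : ℂ)) P))) := by
    rw [toHardy_scale]
    have h2 : ∀ T, mean (fun u => ∑ n ∈ P.support, (expo (Real.log (n : ℕ)) u * (ker Q u : ℂ)) •
        toHardy p (Finsupp.single n (P n))) T = ∑ n ∈ P.support,
        mean (fun u => expo (Real.log (n : ℕ)) u * (ker Q u : ℂ)) T •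
          toHardy p (Finsupp.single n (P n)) := fun T => by
      rw [mean_sum P.support (f := fun n u => (expo (Real.log (n : ℕ)) u * (ker Q u : ℂ)) •
        toHardy p (Finsupp.single n (P n))) fun n _ => (hcont n).smul continuous_const]
      exact Finset.sum_congr rfl fun n _ => mean_smul_const _ _ T
    rw [show mean _ = _ from funext h2]
    exact tendsto_finsetSum _ fun n _ => (tendsto_mean_expo_mul_ker hQ n.ne_zero).smul_const _
  have h3 : ∀ u, ‖∑ n ∈ P.support, (expo (Real.log (n : ℕ)) u * (ker Q u : ℂ)) •
      toHardy p (Finsupp.single n (P n))‖ = ker Q u * polyNorm p P := by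
    intro u
    simp only [mul_comm (expo _ _), mul_smul, ← Finset.smul_sum]
    rw [← toHardy_scale (p := p) (fun n => expo (Real.log (n : ℕ)) u), norm_smul, norm_toHardy,
      polyNorm_scale_expo hp.out, Complex.norm_real, Real.norm_of_nonneg (ker_nonneg Q u)]
  have h4 : Tendsto (fun T => polyNorm p P * mean (ker Q) T) atTop (𝓝 (polyNorm p P * 1)) :=
    (tendsto_mean_ker hQ).const_mul _
  rw [mul_one] at h4
  rw [← norm_toHardy]
  refine le_of_tendsto_of_tendsto h1.norm h4 ?_
  filter_upwards [eventually_gt_atTop 0] with T hT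
  refine (norm_mean_le_integral _ hT).trans (le_of_eq ?_)
  simp only [h3, mean, intervalIntegral.integral_mul_const, smul_eq_mul]
  ring

/-- Fejér-type summation on `ℋ^p`. -/
def fejerL (p : ℝ) [Fact (1 ≤ p)] (Q : ℕ) : Hardy p →L[ℂ] Hardy p :=
  ∑ n ∈ Q.divisors.preimage PNat.val PNat.coe_injective.injOn,
    ((wt Q n : ℂ) • coeffL p n).smulRight (toHardy p (Finsupp.single n 1))

theorem fejerL_toHardy {Q : ℕ} (hQ : Q ≠ 0) (P : ℕ+ →₀ ℂ) :
    fejerL p Q (toHardy p P) = toHardy p (scale (fun n => (wt Q n : ℂ)) P) := by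
  simp only [fejerL, sum_apply, ContinuousLinearMap.smulRight_apply,
    smul_apply, coeffL_toHardy, ← map_smul, ← map_sum]
  congr 1
  ext n
  rw [scale_apply, Finsupp.finsetSum_apply]
  simp only [Finsupp.smul_apply, smul_eq_mul]
  by_cases h : n ∈ Q.divisors.preimage PNat.val PNat.coe_injective.injOn
  · rw [Finset.sum_eq_single_of_mem n h fun m _ hm => by
      rw [Finsupp.single_eq_of_ne hm.symm, mul_zero]]
    simp [mul_comm]
  · have h1 : wt Q n = 0 := wt_eq_zero_of_not_dvd fun hd =>
      h (Finset.mem_preimage.2 (Nat.mem_divisors.2 ⟨hd, hQ⟩))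
    rw [h1, Complex.ofReal_zero, mul_zero]
    refine Finset.sum_eq_zero fun m hm => ?_
    rw [Finsupp.single_eq_of_ne (by rintro rfl; exact h hm), mul_zero]

theorem norm_fejerL_le {Q : ℕ} (hQ : Q ≠ 0) (f : Hardy p) : ‖fejerL p Q f‖ ≤ ‖f‖ := by
  refine hardy_induction f (isClosed_le (fejerL p Q).continuous.norm continuous_norm) fun P => ?_
  rw [fejerL_toHardy hQ, norm_toHardy, norm_toHardy]
  exact polyNorm_scale_wt_le hQ P

/-- Fejér summation factors through finitely many coefficients, so it kills `f`. It is also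
contractive and tends to the identity on polynomials, so a polynomial `P` satisfies `‖P‖ ≤ ‖f - P‖`,
which is impossible for `P` close to a nonzero `f`. -/
theorem eq_zero_of_coeffs_eq_zero {f : Hardy p} (h : coeffs f = 0) : f = 0 := by
  have hf : ∀ Q, fejerL p Q f = 0 := fun Q => by
    have : ∀ n : ℕ+, coeffL p n f = 0 := fun n => by rw [← coeffs_apply, h]; rfl
    simp [fejerL, this]
  by_contra hne
  have hpos : 0 < ‖f‖ / 2 := half_pos (norm_pos_iff.2 hne)
  obtain ⟨P, hP⟩ := denseRange_toHardy.exists_dist_lt f hpos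
  rw [dist_eq_norm] at hP
  have hQ : ∀ k : ℕ, k.factorial ^ k ≠ 0 := fun k => pow_ne_zero _ k.factorial_ne_zero
  have h1 : Tendsto (fun k : ℕ => fejerL p (k.factorial ^ k) (toHardy p P)) atTop
      (𝓝 (toHardy p P)) := by
    have h2 : toHardy p P = toHardy p (scale (fun _ => 1) P) := by
      congr 1; ext n; simp [scale_apply]
    conv => enter [3, 1]; rw [h2]
    simp only [fun k => fejerL_toHardy (p := p) (hQ k) P, toHardy_scale]
    refine tendsto_finsetSum _ fun n _ => Tendsto.smul_const ?_ _
    exact (Complex.continuous_ofReal.tendsto 1).comp (tendsto_wt_factorial_pow n.ne_zero)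
  have h3 : ‖toHardy p P‖ ≤ ‖f - toHardy p P‖ := by
    refine le_of_tendsto' h1.norm fun k => ?_
    have h4 := norm_fejerL_le (hQ k) (f - toHardy p P)
    rwa [map_sub, hf, zero_sub, norm_neg] at h4
  have h5 := norm_sub_norm_le f (toHardy p P)
  linarith

theorem coeffs_injective : Function.Injective (coeffs (p := p)) := fun f g h =>
  sub_eq_zero.1 (eq_zero_of_coeffs_eq_zero (by rw [coeffs_sub, h, sub_self]))

/-! ### Multiplication operators -/

theorem exists_extend (φ : (ℕ+ →₀ ℂ) →ₗ[ℂ] Hardy p) {C : ℝ}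
    (h : ∀ P, ‖φ P‖ ≤ C * polyNorm p P) :
    ∃ M : Hardy p →L[ℂ] Hardy p, ∀ P, M (toHardy p P) = φ P := by
  let ψ : DirichletPoly p →L[ℂ] Hardy p :=
    (φ ∘ₗ (toFinsupp p).toLinearMap).mkContinuous C fun P => h (toFinsupp p P)
  exact ⟨ψ.fromCompletion, fun P => ψ.fromCompletion_apply_coe ((toFinsupp p).symm P)⟩

/-- Partial Fejér-type sums of a series in `ℋ^∞`. -/
def fejerSeq (a : ℕ → ℂ) (k : ℕ) : ℕ+ →₀ ℂ :=
  fejer a (k.factorial ^ k) (pow_ne_zero _ k.factorial_ne_zero)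

theorem tendsto_fejerSeq_apply (a : ℕ → ℂ) (n : ℕ+) :
    Tendsto (fun k => fejerSeq a k n) atTop (𝓝 (a n)) := by
  have h : Tendsto (fun k : ℕ => ((wt (k.factorial ^ k) n : ℝ) : ℂ) * a n) atTop
      (𝓝 ((1 : ℝ) * a n)) :=
    ((Complex.continuous_ofReal.tendsto _).comp (tendsto_wt_factorial_pow n.ne_zero)).mul_const _
  rwa [Complex.ofReal_one, one_mul] at h

/-- The polynomials are uniformly bounded on the imaginary axis, so the `2`-norm decides. There
dominated convergence applies with majorant `|aₙ|²`, as two weights differ by at most `1`. -/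
theorem tendsto_polyNorm_fejerSeq_sub (hD : MemHardyInfty a D) :
    Tendsto (fun k : ℕ × ℕ => polyNorm p (fejerSeq a k.1 - fejerSeq a k.2)) atTop (𝓝 0) := by
  obtain ⟨C, hC⟩ := hD.bounded
  have hev : ∀ k t, ‖evalIm (fejerSeq a k) t‖ ≤ C := fun k t => norm_evalIm_fejer_le hD hC _ t
  refine tendsto_polyNorm_zero hp.out (B := C + C) (fun k t => ?_) ?_
  · rw [← evalImLin_apply, map_sub]
    exact (norm_sub_le _ _).trans (add_le_add (hev _ t) (hev _ t))
  · have h1 : ∀ k : ℕ × ℕ, ∑ n ∈ (fejerSeq a k.1 - fejerSeq a k.2).support,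
        ‖(fejerSeq a k.1 - fejerSeq a k.2) n‖ ^ 2 =
        ∑' n : ℕ+, ‖fejerSeq a k.1 n - fejerSeq a k.2 n‖ ^ 2 := fun k => by
      refine (tsum_eq_sum fun n hn => ?_).symm
      have h0 := Finsupp.notMem_support_iff.1 hn
      rw [h0]; simp
    simp only [h1]
    rw [show (0 : ℝ) = ∑' n : ℕ+, ‖a n - a n‖ ^ 2 by simp]
    refine tendsto_tsum_of_dominated_convergence (summable_sq hD) (fun n => ?_)
      (Eventually.of_forall fun k n => ?_)
    · rw [← prod_atTop_atTop_eq]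
      exact ((((tendsto_fejerSeq_apply a n).comp tendsto_fst).sub
        ((tendsto_fejerSeq_apply a n).comp tendsto_snd)).norm.pow 2)
    · rw [norm_pow, norm_norm]
      refine pow_le_pow_left₀ (norm_nonneg _) ?_ 2
      simp only [fejerSeq, fejer_apply]
      rw [← sub_mul, norm_mul, ← Complex.ofReal_sub, Complex.norm_real, Real.norm_eq_abs]
      refine mul_le_of_le_one_left (norm_nonneg _) (abs_le.2 ⟨?_, ?_⟩)
      · linarith [wt_nonneg (k.1.factorial ^ k.1) n, wt_le_one (k.2.factorial ^ k.2) n]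
      · linarith [wt_nonneg (k.2.factorial ^ k.2) n, wt_le_one (k.1.factorial ^ k.1) n]

/-- Multiplication by a series in `ℋ^∞` is a bounded operator on `ℋ^p`. -/
theorem exists_isMultiplication (hD : MemHardyInfty a D) :
    ∃ M : Hardy p →L[ℂ] Hardy p, IsMultiplication a M := by
  obtain ⟨C, hC⟩ := hD.bounded
  have hC0 : 0 ≤ C := (norm_nonneg _).trans (hC 1 (by simp [halfPlane]))
  let φ : ℕ → (ℕ+ →₀ ℂ) →ₗ[ℂ] Hardy p := fun k => toHardy p ∘ₗ polyMul (fejerSeq a k)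
  have hφ : ∀ k P, φ k P = toHardy p (polyMul (fejerSeq a k) P) := fun _ _ => rfl
  have hbound : ∀ k P, ‖φ k P‖ ≤ C * polyNorm p P := fun k P => by
    rw [hφ, norm_toHardy]
    refine (polyNorm_le_mul hp.out (B := C) fun t => ?_).trans_eq (by rw [abs_of_nonneg hC0])
    rw [evalIm_polyMul, norm_mul]
    exact mul_le_mul_of_nonneg_right (norm_evalIm_fejer_le hD hC _ t) (norm_nonneg _)
  -- For fixed `P` the roles are reversed: `P` is the bounded factor and the Fejér polynomials are
  -- Cauchy in the `p`-norm.
  have hcauchy : ∀ P, CauchySeq fun k => φ k P := fun P => by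
    rw [cauchySeq_iff_tendsto_dist_atTop_0]
    set R := ∑ n ∈ P.support, ‖P n‖
    have h1 := (tendsto_polyNorm_fejerSeq_sub (p := p) hD).const_mul |R|
    rw [mul_zero] at h1
    refine squeeze_zero (fun _ => dist_nonneg) (fun k => ?_) h1
    rw [dist_eq_norm, hφ, hφ, ← map_sub, ← polyMul_sub, norm_toHardy]
    refine polyNorm_le_mul hp.out fun t => ?_
    rw [evalIm_polyMul, norm_mul, mul_comm]
    exact mul_le_mul_of_nonneg_right (norm_evalIm_le P t) (norm_nonneg _)
  choose g hg using fun P => cauchySeq_tendsto_of_complete (hcauchy P)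
  obtain ⟨M, hM⟩ := exists_extend (linearMapOfTendsto g φ (tendsto_pi_nhds.2 hg)) (C := C)
    fun P => le_of_tendsto' (hg P).norm fun k => hbound k P
  refine ⟨M, fun f => coeffs_ext fun n => ?_⟩
  simp only [ArithmeticFunction.mul_apply]
  have hcl : ∀ m : ℕ, Continuous fun f : Hardy p => coeffs f m := fun m => by
    rcases Nat.eq_zero_or_pos m with rfl | hm
    · simpa using continuous_const
    · exact (coeffL p ⟨m, hm⟩).continuous.congr fun f => (coeffs_apply f ⟨m, hm⟩).symm
  -- Each coefficient of a product involves finitely many coefficients of the factors, so the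
  -- identity is closed in `f` and survives the limit in `k`.
  refine hardy_induction f (isClosed_eq ((hcl n).comp M.continuous)
    (continuous_finsetSum _ fun (x : ℕ × ℕ) _ => continuous_const.mul (hcl x.2))) fun P => ?_
  have h1 : Tendsto (fun k => coeffs (φ k P) n) atTop (𝓝 (coeffs (M (toHardy p P)) n)) := by
    rw [hM]
    exact ((hcl n).tendsto _).comp (hg P)
  refine tendsto_nhds_unique h1 ?_
  simp only [hφ, coeffs_polyMul, ArithmeticFunction.mul_apply]
  refine tendsto_finsetSum _ fun x _ => Tendsto.mul_const _ ?_
  rcases Nat.eq_zero_or_pos x.1 with h0 | h0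
  · simp [h0]
  · have h2 := tendsto_fejerSeq_apply a ⟨x.1, h0⟩
    rw [PNat.mk_coe] at h2
    exact h2.congr fun k => (coeffs_toHardy (p := p) _ ⟨x.1, h0⟩).symm

end Hardy

/-! ### Shifting by a constant -/

/-- The Dirichlet series of the constant function `c`. -/
def constAF (c : ℂ) : ArithmeticFunction ℂ where
  toFun n := if n = 1 then c else 0
  map_zero' := by simp

theorem constAF_apply (c : ℂ) (n : ℕ) : constAF c n = if n = 1 then c else 0 := rfl

theorem constAF_mul_apply (c : ℂ) (b : ArithmeticFunction ℂ) (n : ℕ) :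
    (constAF c * b) n = c * b n := by
  rcases eq_or_ne n 0 with rfl | hn
  · simp
  rw [ArithmeticFunction.mul_apply, Finset.sum_eq_single (1, n)]
  · simp [constAF_apply]
  · rintro ⟨i, j⟩ hij hne
    have : i ≠ 1 := by
      rintro rfl
      exact hne (by simpa using (Nat.mem_divisorsAntidiagonal.1 hij).1)
    simp [constAF_apply, this]
  · intro h
    exact absurd (Nat.mem_divisorsAntidiagonal.2 ⟨one_mul n, hn⟩) h

theorem term_sub_constAF (a : ArithmeticFunction ℂ) (c s : ℂ) (n : ℕ) :
    LSeries.term (a - constAF c : ArithmeticFunction ℂ) s n =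
      LSeries.term a s n - if n = 1 then c else 0 := by
  rcases eq_or_ne n 0 with rfl | hn
  · simp
  have h : (a - constAF c : ArithmeticFunction ℂ) n = a n - if n = 1 then c else 0 := by
    rw [sub_eq_add_neg, ArithmeticFunction.add_apply, ArithmeticFunction.neg_apply,
      constAF_apply, sub_eq_add_neg]
  rw [LSeries.term_of_ne_zero hn, LSeries.term_of_ne_zero hn, h, sub_div]
  congr 1
  split_ifs with h1
  · simp [h1]
  · simp

theorem MemHardyInfty.sub_const (hD : MemHardyInfty a D) (c : ℂ) :
    MemHardyInfty (a - constAF c) (fun s => D s - c) := by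
  obtain ⟨C, hC⟩ := hD.bounded
  obtain ⟨σ, hσ, h⟩ := hD.series
  refine ⟨DifferentiableOn.sub_const hD.holo c, ⟨C + ‖c‖, fun s hs => ?_⟩, ⟨σ, hσ, fun s hs => ?_⟩⟩
  · have h1 := norm_sub_le (D s) c
    have h2 := hC s hs
    linarith
  · have h1 : HasSum (fun n => LSeries.term a s n - if n = 1 then c else 0) (D s - c) :=
      HasSum.sub (h s hs) (hasSum_ite_eq 1 c)
    exact h1.congr_fun fun n => term_sub_constAF a c s n

theorem IsMultiplication.sub_const {p : ℝ} [Fact (1 ≤ p)] {M : Hardy p →L[ℂ] Hardy p}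
    (hM : IsMultiplication a M) (c : ℂ) :
    IsMultiplication (a - constAF c) (M - c • ContinuousLinearMap.id ℂ (Hardy p)) := fun f => by
  change coeffs (M f - c • f) = _
  rw [coeffs_sub, hM f, sub_mul]
  congr 1
  ext n
  rw [coeffs_smul, constAF_mul_apply]

/-! ### Inverses in `ℋ^∞` -/

/-- Induction on `a 1 * b n = -∑ a d * b (n / d)` over `d ≥ 2`. In the exponent `k + 2`, two powers
of `1/d` make the sum converge and the other `k` supply a factor `2^{-k}` that beats `C * Z / |a
1|`. -/
theorem exists_norm_le_pow_of_mul_eq_one {b : ArithmeticFunction ℂ} (hab : a * b = 1) {C : ℝ}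
    (hC : ∀ n, ‖a n‖ ≤ C) : ∃ B : ℝ, ∃ K : ℕ, ∀ n, ‖b n‖ ≤ B * (n : ℝ) ^ K := by
  have h11 : a 1 * b 1 = 1 := by
    have := congrArg (fun f : ArithmeticFunction ℂ => f 1) hab
    simpa [ArithmeticFunction.mul_apply] using this
  have ha1 : 0 < ‖a 1‖ := norm_pos_iff.2 (left_ne_zero_of_mul_eq_one h11)
  have hC0 : 0 ≤ C := (norm_nonneg _).trans (hC 0)
  have hsum : Summable fun d : ℕ => 1 / (d : ℝ) ^ 2 :=
    Real.summable_one_div_nat_pow.2 one_lt_two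
  set Z := ∑' d : ℕ, 1 / (d : ℝ) ^ 2
  have hZ : 0 ≤ Z := tsum_nonneg fun d => by positivity
  obtain ⟨k, hk⟩ : ∃ k : ℕ, C * Z * (1 / 2) ^ k ≤ ‖a 1‖ := by
    have h1 : Tendsto (fun k : ℕ => C * Z * (1 / 2 : ℝ) ^ k) atTop (𝓝 (C * Z * 0)) :=
      (tendsto_pow_atTop_nhds_zero_of_lt_one (by norm_num) (by norm_num)).const_mul _
    rw [mul_zero] at h1
    exact (h1.eventually_le_const ha1).exists
  refine ⟨‖b 1‖, k + 2, fun n => ?_⟩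
  induction n using Nat.strong_induction_on with
  | _ n ih =>
    rcases eq_or_ne n 0 with rfl | hn
    · simp
    rcases eq_or_ne n 1 with rfl | hn1
    · simp
    have hn0 : (0 : ℝ) < n := by positivity
    have hmem : (1, n) ∈ n.divisorsAntidiagonal :=
      Nat.mem_divisorsAntidiagonal.2 ⟨one_mul n, hn⟩
    have h0 : ∑ x ∈ n.divisorsAntidiagonal, a x.1 * b x.2 = 0 := by
      rw [← ArithmeticFunction.mul_apply, hab, ArithmeticFunction.one_apply_ne hn1]
    rw [← Finset.add_sum_erase _ _ hmem] at h0
    have h2 : ∀ x ∈ n.divisorsAntidiagonal.erase (1, n), ‖a x.1 * b x.2‖ ≤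
        C * ‖b 1‖ * (n : ℝ) ^ (k + 2) * (1 / 2) ^ k * (1 / (x.1 : ℝ) ^ 2) := by
      rintro ⟨d, e⟩ hx
      obtain ⟨hne, hx⟩ := Finset.mem_erase.1 hx
      obtain ⟨hde, -⟩ := Nat.mem_divisorsAntidiagonal.1 hx
      simp only at hde ⊢
      have hd0 : d ≠ 0 := by rintro rfl; exact hn (by simpa using hde.symm)
      have he0 : e ≠ 0 := by rintro rfl; exact hn (by simpa using hde.symm)
      have hd1 : d ≠ 1 := by rintro rfl; exact hne (by simpa using hde)
      have hd2 : 2 ≤ d := by omega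
      have hlt : e < n := by
        rw [← hde]; exact lt_mul_of_one_lt_left (Nat.pos_of_ne_zero he0) (by omega)
      rw [norm_mul]
      have hd2' : (2 : ℝ) ≤ d := by exact_mod_cast hd2
      have he : (e : ℝ) = n / d := by
        rw [← hde]; push_cast; field_simp
      calc ‖a d‖ * ‖b e‖ ≤ C * (‖b 1‖ * (e : ℝ) ^ (k + 2)) :=
            mul_le_mul (hC d) (ih e hlt) (norm_nonneg _) hC0
        _ = C * ‖b 1‖ * (n : ℝ) ^ (k + 2) * (1 / d) ^ k * (1 / (d : ℝ) ^ 2) := by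
            rw [he, div_pow, pow_add (d : ℝ), one_div_pow]; field_simp
        _ ≤ _ := by gcongr
    have h3 : ‖a 1 * b n‖ ≤ C * ‖b 1‖ * (n : ℝ) ^ (k + 2) * (1 / 2) ^ k * Z := by
      rw [eq_neg_of_add_eq_zero_left h0, norm_neg]
      refine (norm_sum_le _ _).trans ((Finset.sum_le_sum h2).trans ?_)
      rw [← Finset.mul_sum]
      refine mul_le_mul_of_nonneg_left ?_ (by positivity)
      refine (Finset.sum_le_sum_of_subset_of_nonneg (Finset.erase_subset _ _)
        fun _ _ _ => by positivity).trans ?_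
      rw [Nat.sum_divisorsAntidiagonal fun d _ => 1 / (d : ℝ) ^ 2]
      exact hsum.sum_le_tsum _ fun _ _ => by positivity
    rw [norm_mul] at h3
    refine le_of_mul_le_mul_left (h3.trans ?_) ha1
    calc _ = C * Z * (1 / 2) ^ k * (‖b 1‖ * (n : ℝ) ^ (k + 2)) := by ring
      _ ≤ _ := by gcongr

/-- If the sum of a series in `ℋ^∞` is bounded away from `0`, its inverse belongs to `ℋ^∞`. -/
theorem MemHardyInfty.exists_inv (hD : MemHardyInfty a D) {δ : ℝ} (hδ : 0 < δ)
    (h : ∀ s ∈ halfPlane 0, δ ≤ ‖D s‖) :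
    ∃ b : ArithmeticFunction ℂ, a * b = 1 ∧ MemHardyInfty b (fun s => (D s)⁻¹) := by
  obtain ⟨C, hC⟩ := hD.bounded
  obtain ⟨σ, hσ, hser⟩ := hD.series
  have hne : ∀ s ∈ halfPlane 0, D s ≠ 0 := fun s hs =>
    norm_pos_iff.1 (hδ.trans_le (h s hs))
  have hsub : halfPlane σ ⊆ halfPlane 0 := fun s hs => hσ.trans_lt hs
  -- `a 1` is the limit of `D` at `+∞` along the real axis, where `|D| ≥ δ`.
  have ha1 : a 1 ≠ 0 := by
    have habs : LSeries.abscissaOfAbsConv a < ⊤ :=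
      ((hser ((σ + 1 : ℝ) : ℂ) (by simp [halfPlane])).LSeriesSummable.abscissaOfAbsConv_le).trans_lt
        (EReal.coe_lt_top _)
    have h1 := (LSeries.tendsto_atTop habs).norm
    refine norm_pos_iff.1 (hδ.trans_le (ge_of_tendsto h1 ?_))
    filter_upwards [eventually_gt_atTop σ] with x hx
    have hx' : (x : ℂ) ∈ halfPlane σ := by simpa [halfPlane] using hx
    rw [(hser x hx').LSeries_eq]
    exact h _ (hsub hx')
  obtain ⟨b, hab⟩ := (ArithmeticFunction.isUnit_iff_isUnit_apply_one.2
    (isUnit_iff_ne_zero.2 ha1)).exists_right_inv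
  refine ⟨b, hab, hD.holo.inv hne, ⟨δ⁻¹, fun s hs => ?_⟩, ?_⟩
  · rw [norm_inv]
    exact inv_anti₀ hδ (h s hs)
  · obtain ⟨B, K, hB⟩ := exists_norm_le_pow_of_mul_eq_one hab (norm_apply_le hD hC)
    -- Coefficients of size `n^K` give absolute convergence for `Re s > K + 1`; to the right of `σ`
    -- the product formula identifies the sum as `1/D`.
    refine ⟨max σ (K + 1), hσ.trans (le_max_left _ _), fun s hs => ?_⟩
    have hs0 : max σ (K + 1) < s.re := hs
    have hs1 : s ∈ halfPlane σ := (le_max_left σ (K + 1 : ℝ)).trans_lt hs0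
    have hs2 : (K + 1 : ℝ) < s.re := (le_max_right _ _).trans_lt hs0
    have hbs : LSeriesSummable b s :=
      LSeriesSummable_of_le_const_mul_rpow hs2 ⟨B, fun n _ => by
        rw [add_sub_cancel_right, Real.rpow_natCast]; exact hB n⟩
    have h2 := ArithmeticFunction.LSeries_mul' (hser s hs1).LSeriesSummable hbs
    rw [(hser s hs1).LSeries_eq, hab, ArithmeticFunction.one_eq_delta, LSeries_delta,
      Pi.one_apply] at h2
    rw [LSeriesHasSum_iff]
    exact ⟨hbs, (inv_eq_of_mul_eq_one_right h2.symm).symm⟩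

theorem IsMultiplication.surjective {p : ℝ} [Fact (1 ≤ p)] {M : Hardy p →L[ℂ] Hardy p}
    (hM : IsMultiplication a M) (hD : MemHardyInfty a D) {δ : ℝ} (hδ : 0 < δ)
    (h : ∀ s ∈ halfPlane 0, δ ≤ ‖D s‖) : Function.Surjective M := fun f => by
  obtain ⟨b, hab, hb⟩ := hD.exists_inv hδ h
  obtain ⟨N, hN⟩ := exists_isMultiplication (p := p) hb
  exact ⟨N f, coeffs_injective (by rw [hM, hN, ← mul_assoc, hab, one_mul])⟩

/-! ### The part of a Dirichlet series supported on smooth numbers -/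

/-- The restriction of an arithmetic function to the integers all of whose prime factors are at
most `N`. -/
def smoothPart (N : ℕ) (a : ArithmeticFunction ℂ) : ArithmeticFunction ℂ where
  toFun := (Nat.smoothNumbers (N + 1)).indicator a
  map_zero' := by simp [Set.indicator]

theorem smoothPart_apply (N : ℕ) (a : ArithmeticFunction ℂ) (n : ℕ) :
    smoothPart N a n = (Nat.smoothNumbers (N + 1)).indicator a n := rfl

theorem smoothPart_of_mem {N n : ℕ} (a : ArithmeticFunction ℂ)
    (h : n ∈ Nat.smoothNumbers (N + 1)) : smoothPart N a n = a n := Set.indicator_of_mem h _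

theorem smoothPart_of_notMem {N n : ℕ} (a : ArithmeticFunction ℂ)
    (h : n ∉ Nat.smoothNumbers (N + 1)) : smoothPart N a n = 0 := Set.indicator_of_notMem h _

/-- A product is smooth exactly when both factors are. -/
theorem smoothPart_mul (N : ℕ) (a b : ArithmeticFunction ℂ) :
    smoothPart N (a * b) = smoothPart N a * smoothPart N b := by
  ext n
  rw [ArithmeticFunction.mul_apply]
  by_cases h : n ∈ Nat.smoothNumbers (N + 1)
  · rw [smoothPart_of_mem _ h, ArithmeticFunction.mul_apply]
    refine Finset.sum_congr rfl fun x hx => ?_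
    have hx' := (Nat.mem_divisorsAntidiagonal.1 hx).1
    rw [smoothPart_of_mem _ (Nat.mem_smoothNumbers_of_dvd h (Dvd.intro _ hx')),
      smoothPart_of_mem _ (Nat.mem_smoothNumbers_of_dvd h (Dvd.intro_left _ hx'))]
  · rw [smoothPart_of_notMem _ h]
    refine (Finset.sum_eq_zero fun x hx => ?_).symm
    by_cases h1 : x.1 ∈ Nat.smoothNumbers (N + 1)
    · have h2 : x.2 ∉ Nat.smoothNumbers (N + 1) := fun h2 => h (by
        rw [← (Nat.mem_divisorsAntidiagonal.1 hx).1]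
        exact Nat.mul_mem_smoothNumbers h1 h2)
      rw [smoothPart_of_notMem _ h2, mul_zero]
    · rw [smoothPart_of_notMem _ h1, zero_mul]

/-- The sum is a finite Euler product of geometric series of ratio `q^{-σ} < 1`, so no condition `σ
> 1` is needed. -/
theorem summable_smooth (N : ℕ) {σ : ℝ} (hσ : 0 < σ) :
    Summable ((Nat.smoothNumbers (N + 1)).indicator fun n : ℕ => (n : ℝ) ^ (-σ)) := by
  let f : ℕ →* ℝ :=
    { toFun := fun n => (n : ℝ) ^ (-σ)
      map_one' := by simp
      map_mul' := fun m n => by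
        push_cast; exact Real.mul_rpow (Nat.cast_nonneg _) (Nat.cast_nonneg _) }
  have h := (EulerProduct.summable_and_hasSum_smoothNumbers_prod_primesBelow_geometric (f := f)
    (fun {q} hq => by
      change ‖(q : ℝ) ^ (-σ)‖ < 1
      rw [Real.norm_of_nonneg (by positivity)]
      exact Real.rpow_lt_one_of_one_lt_of_neg (by exact_mod_cast hq.one_lt) (by linarith))
    (N + 1)).1.of_norm
  exact summable_subtype_iff_indicator.1 h

theorem norm_term_smoothPart_le {C : ℝ} (hC : ∀ n, ‖a n‖ ≤ C) (N : ℕ) (s : ℂ) (n : ℕ) :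
    ‖LSeries.term (smoothPart N a) s n‖ ≤
      C * (Nat.smoothNumbers (N + 1)).indicator (fun n : ℕ => (n : ℝ) ^ (-s.re)) n := by
  by_cases h : n ∈ Nat.smoothNumbers (N + 1)
  · have hn := Nat.ne_zero_of_mem_smoothNumbers h
    rw [LSeries.norm_term_eq, if_neg hn, smoothPart_of_mem _ h, Set.indicator_of_mem h,
      Real.rpow_neg (Nat.cast_nonneg _), div_eq_mul_inv]
    exact mul_le_mul_of_nonneg_right (hC n) (by positivity)
  · rw [LSeries.norm_term_eq, smoothPart_of_notMem _ h, Set.indicator_of_notMem h]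
    simp

theorem lseriesSummable_smoothPart {C : ℝ} (hC : ∀ n, ‖a n‖ ≤ C) (N : ℕ) {s : ℂ} (hs : 0 < s.re) :
    LSeriesSummable (smoothPart N a) s :=
  Summable.of_norm_bounded ((summable_smooth N hs).mul_left C) (norm_term_smoothPart_le hC N s)

theorem norm_lseries_smoothPart_le_tsum {C : ℝ} (hC : ∀ n, ‖a n‖ ≤ C) (N : ℕ) {s : ℂ}
    (hs : 0 < s.re) : ‖LSeries (smoothPart N a) s‖ ≤
      C * ∑' n, (Nat.smoothNumbers (N + 1)).indicator (fun n : ℕ => (n : ℝ) ^ (-s.re)) n := by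
  rw [← tsum_mul_left]
  exact tsum_of_norm_bounded ((summable_smooth N hs).mul_left C).hasSum
    (norm_term_smoothPart_le hC N s)

theorem differentiableOn_lseries_smoothPart {C : ℝ} (hC : ∀ n, ‖a n‖ ≤ C) (N : ℕ) :
    DifferentiableOn ℂ (LSeries (smoothPart N a)) (halfPlane 0) := by
  refine (LSeries_differentiableOn _).mono fun s hs => ?_
  have h : LSeries.abscissaOfAbsConv (smoothPart N a) ≤ ((0 : ℝ) : EReal) :=
    LSeries.abscissaOfAbsConv_le_of_forall_lt_LSeriesSummable fun y hy =>
      lseriesSummable_smoothPart hC N (by simpa using hy)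
  exact h.trans_lt (EReal.coe_lt_coe_iff.2 hs)

/-- Passing to the smooth part does not increase the bound of the sum on `ℂ_0`. -/
theorem norm_lseries_smoothPart_le (hD : MemHardyInfty a D) {C : ℝ}
    (hC : ∀ s ∈ halfPlane 0, ‖D s‖ ≤ C) (N : ℕ) {s : ℂ} (hs : 0 < s.re) :
    ‖LSeries (smoothPart N a) s‖ ≤ C := by
  have hQ : ∀ k : ℕ, N.factorial ^ k ≠ 0 := fun k => pow_ne_zero _ N.factorial_ne_zero
  have h1 : ∀ k, ∑ n ∈ (N.factorial ^ k).divisors,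
      (wt (N.factorial ^ k) n : ℂ) * LSeries.term a s n =
      ∑' n, (wt (N.factorial ^ k) n : ℂ) * LSeries.term a s n := fun k => by
    refine (tsum_eq_sum fun n hn => ?_).symm
    rw [wt_eq_zero_of_not_dvd fun h => hn (Nat.mem_divisors.2 ⟨h, hQ k⟩)]
    simp
  -- All weights vanish off the smooth numbers, where the terms have a summable majorant even if the
  -- full series diverges at `s`.
  have h2 : Tendsto (fun k => ∑' n, (wt (N.factorial ^ k) n : ℂ) * LSeries.term a s n) atTop
      (𝓝 (LSeries (smoothPart N a) s)) := by
    refine tendsto_tsum_of_dominated_convergence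
      ((summable_smooth N hs).mul_left C) (fun n => ?_) (Eventually.of_forall fun k n => ?_)
    · by_cases h : n ∈ Nat.smoothNumbers (N + 1)
      · have h3 : LSeries.term (smoothPart N a) s n = ((1 : ℝ) : ℂ) * LSeries.term a s n := by
          have hn := Nat.ne_zero_of_mem_smoothNumbers h
          rw [LSeries.term_of_ne_zero hn, LSeries.term_of_ne_zero hn, smoothPart_of_mem _ h]; simp
        rw [h3]
        exact ((Complex.continuous_ofReal.tendsto _).comp (tendsto_wt_smooth h)).mul_const _
      · have h3 : LSeries.term (smoothPart N a) s n = 0 := by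
          rw [LSeries.term_def, smoothPart_of_notMem _ h]; simp
        rw [h3]
        simp [wt_eq_zero_of_not_smooth h]
    · refine le_trans ?_ (norm_term_smoothPart_le (norm_apply_le hD hC) N s n)
      rw [norm_mul, Complex.norm_real, Real.norm_of_nonneg (wt_nonneg _ _)]
      by_cases h : n ∈ Nat.smoothNumbers (N + 1)
      · rw [LSeries.norm_term_eq, LSeries.norm_term_eq, smoothPart_of_mem _ h]
        refine mul_le_of_le_one_left ?_ (wt_le_one _ _)
        split_ifs <;> positivity
      · rw [wt_eq_zero_of_not_smooth h, zero_mul]; positivity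
  refine le_of_tendsto' h2.norm fun k => ?_
  rw [← h1]
  exact norm_sum_wt_le hD hC (hQ k) hs

/-- In a half-plane of absolute convergence, the smooth parts converge uniformly on vertical
lines. -/
theorem exists_tendsto_norm_sub_smoothPart_le {u : ℝ}
    (hu : ∀ s : ℂ, s.re = u → LSeriesHasSum a s (D s)) (hu0 : 0 < u) {C : ℝ} (hC : ∀ n, ‖a n‖ ≤ C) :
    ∃ e : ℕ → ℝ, Tendsto e atTop (𝓝 0) ∧
      ∀ N, ∀ s : ℂ, s.re = u → ‖D s - LSeries (smoothPart N a) s‖ ≤ e N := by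
  have hsum : Summable fun n => ‖LSeries.term a u n‖ := (hu u (by simp)).summable.norm
  have hle : ∀ N n, ‖(Nat.smoothNumbers (N + 1))ᶜ.indicator (fun n => ‖LSeries.term a u n‖) n‖ ≤
      ‖LSeries.term a u n‖ := fun N n => by
    refine (norm_indicator_le_norm_self _ _).trans (by rw [norm_norm])
  refine ⟨fun N => ∑' n, (Nat.smoothNumbers (N + 1))ᶜ.indicator
    (fun n => ‖LSeries.term a u n‖) n, ?_, fun N s hs => ?_⟩
  · rw [show (0 : ℝ) = ∑' _ : ℕ, 0 by simp]
    refine tendsto_tsum_of_dominated_convergence hsum (fun n => ?_)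
      (Eventually.of_forall hle)
    refine tendsto_const_nhds.congr' ?_
    filter_upwards [eventually_ge_atTop n] with N hN
    rcases Nat.eq_zero_or_pos n with rfl | hn
    · simp [Set.indicator]
    · rw [Set.indicator_of_notMem]
      exact fun h => h (Nat.mem_smoothNumbers_of_lt hn (by omega))
  · rw [← (hu s hs).LSeries_eq, LSeries, LSeries, ← (hu s hs).summable.tsum_sub
      (lseriesSummable_smoothPart hC N (by rw [hs]; exact hu0))]
    refine tsum_of_norm_bounded (hsum.indicator _).hasSum fun n => ?_
    have h1 : ‖LSeries.term a u n‖ = ‖LSeries.term a s n‖ := by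
      rw [LSeries.norm_term_eq, LSeries.norm_term_eq, hs, Complex.ofReal_re]
    by_cases h : n ∈ Nat.smoothNumbers (N + 1)
    · rw [LSeries.term_def, LSeries.term_def, smoothPart_of_mem _ h, sub_self, norm_zero]
      exact Set.indicator_nonneg (fun _ _ => norm_nonneg _) _
    · rw [Set.indicator_of_mem h, h1, LSeries.term_def (smoothPart N a), smoothPart_of_notMem _ h]
      simp

/-- Three lines theorem for the difference: it is bounded on the line `Re = ε / 2` and tends to `0`
uniformly on a line of absolute convergence, so it tends to `0` in between. -/
theorem tendstoUniformlyOn_smoothPart (hD : MemHardyInfty a D) {ε u' : ℝ} (hε : 0 < ε) :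
    TendstoUniformlyOn (fun N => LSeries (smoothPart N a)) D atTop
      {z | ε ≤ z.re ∧ z.re ≤ u'} := by
  obtain ⟨C, hC⟩ := hD.bounded
  have hC0 : 0 ≤ C := (norm_nonneg _).trans (hC 1 (by simp [halfPlane]))
  obtain ⟨σ, hσ, hser⟩ := hD.series
  set u : ℝ := max (σ + 1) (max u' ε)
  have hu0 : 0 < u := lt_of_lt_of_le (by linarith) (le_max_left (σ + 1) _)
  have huε : ε ≤ u := (le_max_right u' ε).trans (le_max_right _ _)
  have huu' : u' ≤ u := (le_max_left u' ε).trans (le_max_right _ _)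
  have huσ : σ < u := lt_of_lt_of_le (by linarith) (le_max_left (σ + 1) _)
  obtain ⟨e, he, heN⟩ := exists_tendsto_norm_sub_smoothPart_le (a := a) (D := D) (u := u)
    (fun s hs => hser s (by simpa [halfPlane, hs] using huσ)) hu0 (norm_apply_le hD hC)
  set l : ℝ := ε / 2
  have hl : 0 < l := half_pos hε
  have hle : l < ε := half_lt_self hε
  have hlu : l < u := hle.trans_le huε
  have he0 : ∀ N, 0 ≤ e N := fun N => (norm_nonneg _).trans (heN N u (by simp))
  set θ₀ := (ε - l) / (u - l)
  have hθ₀ : 0 < θ₀ := div_pos (by linarith) (by linarith)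
  -- `θ₀` is the interpolation exponent at `Re z = ε`, the smallest in the strip and hence the worst
  -- once `e N < 1`. The bound is `2 * C + 1` rather than `2 * C` so that its powers with exponent
  -- at most `1` do not exceed it.
  have hlim : Tendsto (fun N => (2 * C + 1) * e N ^ θ₀) atTop (𝓝 0) := by
    have h1 := (he.rpow_const (p := θ₀) (Or.inr hθ₀.le)).const_mul (2 * C + 1)
    rwa [Real.zero_rpow hθ₀.ne', mul_zero] at h1
  rw [Metric.tendstoUniformlyOn_iff]
  intro η hη
  filter_upwards [(tendsto_order.1 hlim).2 η hη, (tendsto_order.1 he).2 1 one_pos]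
    with N hN hN1 z hz
  rw [dist_eq_norm]
  refine lt_of_le_of_lt ?_ hN
  have hpos : ∀ w ∈ Complex.HadamardThreeLines.verticalClosedStrip l u, 0 < w.re := fun w hw =>
    hl.trans_le hw.1
  have hbd : ∀ w : ℂ, 0 < w.re → ‖D w - LSeries (smoothPart N a) w‖ ≤ 2 * C + 1 := fun w hw => by
    have h1 := norm_sub_le (D w) (LSeries (smoothPart N a) w)
    have h2 := hC w hw
    have h3 := norm_lseries_smoothPart_le hD hC N hw
    linarith
  have hdiff : DifferentiableOn ℂ (fun w => D w - LSeries (smoothPart N a) w) (halfPlane 0) :=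
    hD.holo.sub (differentiableOn_lseries_smoothPart (norm_apply_le hD hC) N)
  have hdc : DiffContOnCl ℂ (fun w => D w - LSeries (smoothPart N a) w)
      (Complex.HadamardThreeLines.verticalStrip l u) := by
    refine DifferentiableOn.diffContOnCl (hdiff.mono fun w hw => ?_)
    have hcl : closure (Complex.HadamardThreeLines.verticalStrip l u) ⊆
        Complex.re ⁻¹' Set.Icc l u :=
      closure_minimal (Set.preimage_mono Set.Ioo_subset_Icc_self)
        (isClosed_Icc.preimage Complex.continuous_re)
    exact hpos w (hcl hw)
  have hzs : z ∈ Complex.HadamardThreeLines.verticalClosedStrip l u :=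
    ⟨hle.le.trans hz.1, hz.2.trans huu'⟩
  have h3 := Complex.HadamardThreeLines.norm_le_interp_of_mem_verticalClosedStrip' hlu hzs hdc
    ⟨2 * C + 1, by rintro _ ⟨w, hw, rfl⟩; exact hbd w (hpos w hw)⟩
    (fun w hw => hbd w (by rw [show w.re = l from hw]; exact hl)) (fun w hw => heN N w hw)
  refine h3.trans (mul_le_mul ?_ ?_ (Real.rpow_nonneg (he0 N) _) (by positivity))
  · refine (Real.rpow_le_rpow_of_exponent_le (by linarith) ?_).trans_eq (Real.rpow_one _)
    have : 0 ≤ (z.re - l) / (u - l) := div_nonneg (by linarith [hz.1]) (by linarith)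
    linarith
  · refine Real.rpow_le_rpow_of_exponent_ge_of_imp (he0 N) hN1.le ?_ ?_
    · exact div_le_div_of_nonneg_right (by linarith [hz.1]) (by linarith)
    · intro _ h
      exact absurd h (div_pos (by linarith [hz.1]) (by linarith)).ne'

/-! ### Zeros of the sum are approximated by zeros of the smooth parts -/

theorem isPreconnected_halfPlane (σ : ℝ) : IsPreconnected (halfPlane σ) :=
  (convex_halfSpace_re_gt σ).isPreconnected

theorem eq_zero_of_eqOn_zero (hD : MemHardyInfty a D) (h : ∀ s ∈ halfPlane 0, D s = 0) : a = 0 := by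
  ext n
  exact norm_le_zero_iff.1 (norm_apply_le hD (C := 0) (fun s hs => by rw [h s hs, norm_zero]) n)

/-- Hurwitz's theorem through a quantitative open mapping theorem: if `|F - F s₀| ≥ δ / 2` on a
circle around `s₀`, the image of the closed disc covers the ball of radius `δ / 4` about `F s₀`, and
this ball contains `0` because `|F s₀| < δ / 4`. -/
theorem exists_zero_smoothPart (hD : MemHardyInfty a D) (ha : a ≠ 0) {s₀ : ℂ}
    (hs₀ : s₀ ∈ halfPlane 0) (h0 : D s₀ = 0) :
    ∃ N, ∃ s ∈ halfPlane 0, LSeries (smoothPart N a) s = 0 := by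
  obtain ⟨C, hC⟩ := hD.bounded
  have hre : 0 < s₀.re := hs₀
  have han : AnalyticOnNhd ℂ D (halfPlane 0) := hD.holo.analyticOnNhd (isOpen_halfPlane 0)
  have hne : ∀ᶠ z in 𝓝[≠] s₀, D z ≠ 0 := by
    refine (han s₀ hs₀).eventually_eq_zero_or_eventually_ne_zero.resolve_left fun h => ha ?_
    exact eq_zero_of_eqOn_zero hD
      (han.eqOn_zero_of_preconnected_of_eventuallyEq_zero (isPreconnected_halfPlane 0) hs₀ h)
  obtain ⟨r₀, hr₀, hball⟩ := Metric.eventually_nhds_iff.1 (eventually_nhdsWithin_iff.1 hne)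
  set r := min r₀ s₀.re / 2
  have hr : 0 < r := half_pos (lt_min hr₀ hre)
  have hrr₀ : r < r₀ := (half_lt_self (lt_min hr₀ hre)).trans_le (min_le_left _ _)
  have hrs : r < s₀.re := (half_lt_self (lt_min hr₀ hre)).trans_le (min_le_right _ _)
  have hcb : ∀ z ∈ Metric.closedBall s₀ r, s₀.re - r ≤ z.re ∧ z.re ≤ s₀.re + r := fun z hz => by
    have h1 := (Complex.abs_re_le_norm (z - s₀)).trans (mem_closedBall_iff_norm.1 hz)
    rw [Complex.sub_re] at h1
    have := abs_le.1 h1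
    constructor <;> linarith
  have hsub : Metric.closedBall s₀ r ⊆ halfPlane 0 := fun z hz => by
    have := (hcb z hz).1
    change 0 < z.re
    linarith
  have hsph : (Metric.sphere s₀ r).Nonempty := NormedSpace.sphere_nonempty.2 hr.le
  obtain ⟨w, hw, hmin⟩ := (isCompact_sphere s₀ r).exists_isMinOn hsph
    (hD.holo.continuousOn.mono (Metric.sphere_subset_closedBall.trans hsub)).norm
  set δ := ‖D w‖
  have hδ : 0 < δ := norm_pos_iff.2 (hball (by rw [Metric.mem_sphere.1 hw]; exact hrr₀)
    (by rintro rfl; simp at hw; exact hr.ne hw))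
  obtain ⟨N, hN⟩ := ((Metric.tendstoUniformlyOn_iff.1
    (tendstoUniformlyOn_smoothPart hD (ε := s₀.re - r) (u' := s₀.re + r) (by linarith))
      (δ / 4) (by positivity)).exists)
  set F := LSeries (smoothPart N a)
  have hF : DifferentiableOn ℂ F (halfPlane 0) :=
    differentiableOn_lseries_smoothPart (norm_apply_le hD hC) N
  have hclose : ∀ z ∈ Metric.closedBall s₀ r, ‖D z - F z‖ < δ / 4 := fun z hz => by
    rw [← dist_eq_norm]; exact hN z (hcb z hz)
  have hF0 : ‖F s₀‖ < δ / 4 := by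
    have := hclose s₀ (Metric.mem_closedBall_self hr.le)
    rwa [h0, zero_sub, norm_neg] at this
  have hbig : ∀ z ∈ Metric.sphere s₀ r, δ / 2 ≤ ‖F z - F s₀‖ := fun z hz => by
    have h1 : δ ≤ ‖D z‖ := hmin hz
    have h2 := hclose z (Metric.sphere_subset_closedBall hz)
    have h3 : ‖D z‖ ≤ ‖D z - F z‖ + ‖F z - F s₀‖ + ‖F s₀‖ := by
      have := norm_add₃_le (a := D z - F z) (b := F z - F s₀) (c := F s₀)
      simpa using this
    linarith
  -- If `F` were locally constant at `s₀`, it would be constant on `ℂ_0`, against the lower bound on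
  -- the circle.
  have hfreq : ∃ᶠ z in 𝓝 s₀, F z ≠ F s₀ := by
    intro h
    have h1 : F =ᶠ[𝓝 s₀] fun _ => F s₀ := by
      filter_upwards [h] with z hz
      simpa using hz
    have h2 := (hF.analyticOnNhd (isOpen_halfPlane 0)).eqOn_of_preconnected_of_eventuallyEq
      analyticOnNhd_const (isPreconnected_halfPlane 0) hs₀ h1
    have h3 := hbig w hw
    rw [h2 (hsub (Metric.sphere_subset_closedBall hw)), sub_self, norm_zero] at h3
    linarith
  have hdc : DiffContOnCl ℂ F (Metric.ball s₀ r) :=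
    DifferentiableOn.diffContOnCl (hF.mono (Metric.closure_ball_subset_closedBall.trans hsub))
  obtain ⟨z, hz, hFz⟩ := hdc.ball_subset_image_closedBall hr hbig hfreq
    (show (0 : ℂ) ∈ Metric.ball (F s₀) (δ / 2 / 2) by
      rw [mem_ball_iff_norm, zero_sub, norm_neg]; linarith)
  exact ⟨N, z, hsub hz, hFz⟩

/-! ### Multiplication by a function with a zero -/

variable {p : ℝ} [Fact (1 ≤ p)]

/-- Evaluation of the smooth part of an element of `ℋ^p` at a point of `ℂ_0`. -/
def smoothEval (p : ℝ) [Fact (1 ≤ p)] (N : ℕ) (s : ℂ) (hs : 0 < s.re) : Hardy p →L[ℂ] ℂ :=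
  LinearMap.mkContinuous
    { toFun := fun f => LSeries (smoothPart N (coeffs f)) s
      map_add' := fun f g => by
        have h : (smoothPart N (coeffs (f + g)) : ℕ → ℂ) =
            smoothPart N (coeffs f) + smoothPart N (coeffs g) := by
          rw [coeffs_add]
          funext n
          simp only [Pi.add_apply, smoothPart_apply, Set.indicator]
          split_ifs <;> simp
        rw [h, LSeries_add (lseriesSummable_smoothPart (norm_coeffs_le f) N hs)
          (lseriesSummable_smoothPart (norm_coeffs_le g) N hs)]
      map_smul' := fun c f => by
        have h : (smoothPart N (coeffs (c • f)) : ℕ → ℂ) = c • ⇑(smoothPart N (coeffs f)) := by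
          funext n
          simp only [Pi.smul_apply, smoothPart_apply, Set.indicator, coeffs_smul, smul_eq_mul]
          split_ifs <;> simp
        rw [h, LSeries_smul]; rfl }
    (∑' n, (Nat.smoothNumbers (N + 1)).indicator (fun n : ℕ => (n : ℝ) ^ (-s.re)) n)
    fun f => (norm_lseries_smoothPart_le_tsum (norm_coeffs_le f) N hs).trans_eq (mul_comm _ _)

theorem smoothEval_apply (N : ℕ) (s : ℂ) (hs : 0 < s.re) (f : Hardy p) :
    smoothEval p N s hs f = LSeries (smoothPart N (coeffs f)) s := rfl

theorem coeffs_toHardy_single_one (n : ℕ) :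
    coeffs (toHardy p (Finsupp.single 1 1)) n = if n = 1 then 1 else 0 := by
  rcases Nat.eq_zero_or_pos n with rfl | hn
  · simp
  · obtain ⟨m, rfl⟩ : ∃ m : ℕ+, n = m := ⟨⟨n, hn⟩, rfl⟩
    rw [coeffs_toHardy, Finsupp.single_apply]
    refine if_congr ?_ rfl rfl
    rw [eq_comm]
    exact PNat.coe_eq_one_iff.symm

theorem smoothEval_one (N : ℕ) (s : ℂ) (hs : 0 < s.re) :
    smoothEval p N s hs (toHardy p (Finsupp.single 1 1)) = 1 := by
  rw [smoothEval_apply, LSeries, tsum_eq_single 1]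
  · rw [LSeries.term_of_ne_zero one_ne_zero, smoothPart_of_mem, coeffs_toHardy_single_one]
    · simp
    · exact Nat.mem_smoothNumbers'.2 fun q hq h => absurd (Nat.dvd_one.1 h) hq.ne_one
  · intro n hn
    rw [LSeries.term_def, smoothPart_apply, Set.indicator, coeffs_toHardy_single_one, if_neg hn]
    simp

theorem IsMultiplication.not_injective_and_denseRange {M : Hardy p →L[ℂ] Hardy p}
    (hM : IsMultiplication a M) (hD : MemHardyInfty a D) {s₀ : ℂ} (hs₀ : s₀ ∈ halfPlane 0)
    (h0 : D s₀ = 0) : ¬ (Function.Injective M ∧ DenseRange M) := by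
  rintro ⟨hinj, hdense⟩
  set e : Hardy p := toHardy p (Finsupp.single 1 1)
  -- The zero series does occur: it arises when the original `D` is the constant `λ`. Injectivity
  -- fails then; otherwise density does.
  rcases eq_or_ne a 0 with rfl | ha
  · have h1 : M e = M 0 := coeffs_injective (by rw [hM, hM, zero_mul, zero_mul])
    have h2 : coeffs e 1 = 0 := by
      rw [hinj h1]
      simpa using coeffs_apply (0 : Hardy p) 1
    rw [coeffs_toHardy_single_one] at h2
    simp at h2
  · obtain ⟨C, hC⟩ := hD.bounded
    obtain ⟨N, s, hs', hz⟩ := exists_zero_smoothPart hD ha hs₀ h0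
    have hs : 0 < s.re := hs'
    have h1 : ∀ f, smoothEval p N s hs (M f) = 0 := fun f => by
      rw [smoothEval_apply, hM, smoothPart_mul, ArithmeticFunction.LSeries_mul'
        (lseriesSummable_smoothPart (norm_apply_le hD hC) N hs)
        (lseriesSummable_smoothPart (norm_coeffs_le f) N hs), hz, zero_mul]
    have h2 : ⇑(smoothEval p N s hs) = fun _ => 0 :=
      hdense.equalizer (smoothEval p N s hs).continuous continuous_const (funext h1)
    have h3 := smoothEval_one (p := p) N s hs
    rw [h2] at h3
    exact zero_ne_one h3

end DirichletHardy

end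

/-! ### The continuous spectrum of a multiplication operator -/

theorem mainTheorem9 (p : ℝ) [Fact (1 ≤ p)] (a : ArithmeticFunction ℂ) (D : ℂ → ℂ)
    (hD : DirichletHardy.MemHardyInfty a D) (ha : a ≠ 0) :
    (∃ M : DirichletHardy.Hardy p →L[ℂ] DirichletHardy.Hardy p,
      DirichletHardy.IsMultiplication a M) ∧
    ∀ M : DirichletHardy.Hardy p →L[ℂ] DirichletHardy.Hardy p,
      DirichletHardy.IsMultiplication a M →
        DirichletHardy.continuousSpectrum M ⊆
          closure (D '' DirichletHardy.halfPlane 0) \ (D '' DirichletHardy.halfPlane 0) := by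
  refine ⟨DirichletHardy.exists_isMultiplication hD, fun M hM l hl => ?_⟩
  obtain ⟨hinj, hdense, hclosed⟩ := hl
  have hDl := hD.sub_const l
  have hMl := hM.sub_const l
  refine ⟨?_, ?_⟩
  -- Outside the closure of the values, `D - l` is bounded away from `0`; surjectivity then makes
  -- the range closed, against `hclosed`.
  · by_contra hcl
    obtain ⟨δ, hδ, hball⟩ := Metric.isOpen_iff.1 isClosed_closure.isOpen_compl l hcl
    refine hclosed ?_
    rw [(hMl.surjective hDl hδ fun s hs => ?_).range_eq]
    · exact isClosed_univ
    · by_contra hlt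
      exact hball (mem_ball_iff_norm.2 (not_le.1 hlt))
        (subset_closure (Set.mem_image_of_mem D hs))
  · rintro ⟨s₀, hs₀, h0⟩
    exact hMl.not_injective_and_denseRange hDl hs₀ (sub_eq_zero.2 h0) ⟨hinj, hdense⟩
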